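/- Let $\Phi^t : \mathcal M \to \mathcal M$, $t \in \mathbb R$, be a continuous flow on a metric space $\mathcal M$ with an ergodic invariant Borel probability measure $\mu$ of compact support. Let $H = L^2(\mu)$ (complex-valued), let $U^t f = f \circ \Phi^t$ be the unitary Koopman group on $H$, and let $V f = \lim_{t \to 0} (U^t f - f)/t$ be its skew-adjoint generator, defined on all $f \in H$ for which the limit exists in $H$. Let $E$ be the spectral measure of $V$ on the Borel subsets of $i\mathbb R$, so that $V = \int_{i\mathbb R} \lambda \, dE(\lambda)$, and let $\Pi_+ = E(i(0,\infty))$ be the projection onto the positive-frequency subspace. Fix $S > 0$. For integers $m, n \ge 1$ let $$T_{m,n} = \left[-\frac{n^2 S}{m(2n+1)}, \frac{n^2 S}{m(2n+1)}\right].$$ Let $h_m : \mathbb R \to [0,\infty)$, $m \ge 1$, be smooth functions with $\operatorname{supp} h_m \subseteq [0, 2\pi m/S]$ that are uniformly bounded ($\sup_{m} \sup_{\omega} h_m(\omega) < \infty$) and satisfy $\lim_{m\to\infty} h_m(\omega) = \chi_{(0,\infty)}(\omega)$ for every $\omega \in \mathbb R$. Define, for $f \in H$, $$P_{m,n} f =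 \frac{1}{2\pi} \int_{\mathbb R^2} h_m(\omega)\, \chi_{T_{m,n}}(t)\, e^{-i\omega t}\, U^t f \, d(\omega,t).$$ Then the integrand is Bochner integrable for all $m, n \ge 1$ and $f \in H$, and the operators $P_{m,n}$ converge strongly to $\Pi_+$ in the sense of the iterated limit: for every $f \in H$ the limit $\lim_{n\to\infty} P_{m,n} f$ exists in $H$ for each $m \ge 1$, and $$\Pi_+ f = \lim_{m\to\infty} \lim_{n\to\infty} P_{m,n} f .$$ -/

import Mathlib

open MeasureTheory Filter Topology Set
open scoped ENNReal InnerProductSpace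

noncomputable section

/-! ### Projection-valued measures and spectral measures -/

/-- A projection-valued measure (PVM) on a measurable space `α`, acting on a Hilbert space `H`.
Only the values on measurable sets matter. -/
structure ProjectionValuedMeasure (α : Type*) [MeasurableSpace α] (H : Type*)
    [NormedAddCommGroup H] [InnerProductSpace ℂ H] [CompleteSpace H] where
  /-- The projection attached to a set. -/
  proj : Set α → H →L[ℂ] H
  isStarProjection : ∀ s, MeasurableSet s → IsStarProjection (proj s)
  proj_empty : proj ∅ = 0
  proj_univ : proj univ = 1
  proj_inter : ∀ s t, MeasurableSet s → MeasurableSet t → proj (s ∩ t) = proj s * proj t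
  hasSum_proj : ∀ s : ℕ → Set α, (∀ i, MeasurableSet (s i)) →
    Pairwise (Function.onFun Disjoint s) →
    ∀ f : H, HasSum (fun i => proj (s i) f) (proj (⋃ i, s i) f)

namespace ProjectionValuedMeasure

variable {α : Type*} [MeasurableSpace α] {H : Type*}
  [NormedAddCommGroup H] [InnerProductSpace ℂ H] [CompleteSpace H]

theorem re_inner_proj (E : ProjectionValuedMeasure α H) {s : Set α} (hs : MeasurableSet s)
    (f : H) : (⟪f, E.proj s f⟫_ℂ).re = ‖E.proj s f‖ ^ 2 := by
  have h := E.isStarProjection s hs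
  have h1 : E.proj s (E.proj s f) = E.proj s f := by
    have := h.isIdempotentElem.eq
    exact congrArg (fun T : H →L[ℂ] H => T f) this
  have h2 : ⟪E.proj s f, E.proj s f⟫_ℂ = ⟪f, E.proj s f⟫_ℂ := by
    have hadj : ContinuousLinearMap.adjoint (E.proj s) = E.proj s := h.isSelfAdjoint.star_eq
    calc ⟪E.proj s f, E.proj s f⟫_ℂ
        = ⟪ContinuousLinearMap.adjoint (E.proj s) f, E.proj s f⟫_ℂ := by rw [hadj]
      _ = ⟪f, E.proj s f⟫_ℂ := by rw [ContinuousLinearMap.adjoint_inner_left, h1]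
  rw [← h2, inner_self_eq_norm_sq_to_K]
  norm_cast

/-- The finite Borel measure `ν_f(s) = ⟪f, E(s) f⟫ = ‖E(s) f‖ ^ 2` of a vector `f`. -/
def scalarMeasure (E : ProjectionValuedMeasure α H) (f : H) : Measure α :=
  Measure.ofMeasurable (fun s _ => ENNReal.ofReal (⟪f, E.proj s f⟫_ℂ).re)
    (by simp [E.proj_empty])
    (by
      intro s hs hd
      have h1 : HasSum (fun i => (⟪f, E.proj (s i) f⟫_ℂ).re)
          (⟪f, E.proj (⋃ i, s i) f⟫_ℂ).re :=
        Complex.hasSum_re ((innerSL ℂ f).hasSum (E.hasSum_proj s hs hd f))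
      rw [← h1.tsum_eq, ENNReal.ofReal_tsum_of_nonneg (fun i => ?_) h1.summable]
      rw [E.re_inner_proj (hs i)]
      positivity)

/-- `E` is the spectral measure of the (unbounded) operator `A`, with the point `x` standing for
the spectral value `φ x`; that is, `A = ∫ φ dE`.  The spectral integral `∫ φ dE` is the operator
with domain `{f | ∫ |φ|² dν_f < ∞}` and quadratic form `⟪f, (∫ φ dE) f⟫ = ∫ φ dν_f`. -/
structure IsSpectralMeasureOf (E : ProjectionValuedMeasure α H) (φ : α → ℂ)
    (A : H →ₗ.[ℂ] H) : Prop where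
  mem_domain_iff : ∀ f : H,
    f ∈ A.domain ↔ ∫⁻ x, ENNReal.ofReal (‖φ x‖ ^ 2) ∂(E.scalarMeasure f) < ∞
  inner_apply : ∀ f : A.domain, ⟪(f : H), A f⟫_ℂ = ∫ x, φ x ∂(E.scalarMeasure (f : H))

end ProjectionValuedMeasure

open Classical in
/-- The spectral projection `E(iΘ)`, `Θ ⊆ ℝ`, of a skew-adjoint operator `V`, where `E` is the
spectral measure of `V` on the imaginary axis: `V = ∫ iω dE(iω)`.  The imaginary axis is
parametrized by the frequency `ω ∈ ℝ`.  (The value is `0` if `V` has no spectral measure; every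
skew-adjoint operator has exactly one.) -/
def skewSpectralProjection {H : Type*} [NormedAddCommGroup H] [InnerProductSpace ℂ H]
    [CompleteSpace H] (V : H →ₗ.[ℂ] H) (Θ : Set ℝ) : H →L[ℂ] H :=
  if h : ∃ E : ProjectionValuedMeasure ℝ H,
      E.IsSpectralMeasureOf (fun ω : ℝ => Complex.I * (ω : ℂ)) V
  then h.choose.proj Θ else 0

/-! ### Generators of one-parameter families -/

/-- The difference quotients of `t ↦ U t f` at `t = 0` converge in norm to `g`. -/
def HasGeneratorAt {H : Type*} [NormedAddCommGroup H] [InnerProductSpace ℂ H]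
    (U : ℝ → H →L[ℂ] H) (f g : H) : Prop :=
  Tendsto (fun t : ℝ => ((t⁻¹ : ℝ) : ℂ) • (U t f - f)) (𝓝[≠] 0) (𝓝 g)

/-- The generator `V f = lim_{t → 0} (U t f - f) / t`, defined on all `f` for which the limit
exists. -/
def generator {H : Type*} [NormedAddCommGroup H] [InnerProductSpace ℂ H]
    (U : ℝ → H →L[ℂ] H) : H →ₗ.[ℂ] H where
  domain :=
    { carrier := {f | ∃ g, HasGeneratorAt U f g}
      add_mem' := by
        rintro f₁ f₂ ⟨g₁, h₁⟩ ⟨g₂, h₂⟩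
        refine ⟨g₁ + g₂, (h₁.add h₂).congr fun t => ?_⟩
        rw [map_add, ← smul_add]; congr 1; abel
      zero_mem' := ⟨0, by simp [HasGeneratorAt]⟩
      smul_mem' := by
        rintro c f ⟨g, h⟩
        refine ⟨c • g, (h.const_smul c).congr fun t => ?_⟩
        rw [map_smul, ← smul_sub, smul_comm] }
  toFun :=
    { toFun := fun f => f.2.choose
      map_add' := by
        intro f₁ f₂
        refine tendsto_nhds_unique (f₁ + f₂).2.choose_spec
          ((f₁.2.choose_spec.add f₂.2.choose_spec).congr fun t => ?_)
        rw [Submodule.coe_add, map_add, ← smul_add]; congr 1; abel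
      map_smul' := by
        intro c f
        refine tendsto_nhds_unique (c • f).2.choose_spec
          ((f.2.choose_spec.const_smul c).congr fun t => ?_)
        rw [Submodule.coe_smul, map_smul, ← smul_sub, smul_comm] }

/-! ### Ergodic flows and Koopman operators -/

/-- The measure `μ` is invariant and ergodic under the flow `Φ`. -/
structure IsErgodicFlow {X : Type*} [TopologicalSpace X] [MeasurableSpace X]
    (Φ : Flow ℝ X) (μ : Measure X) : Prop where
  measurePreserving : ∀ t : ℝ, MeasurePreserving (Φ t) μ μ
  ergodic : ∀ A : Set X, MeasurableSet A → (∀ t : ℝ, Φ t ⁻¹' A = A) → μ A = 0 ∨ μ A = 1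

section Koopman

variable {X : Type*} [TopologicalSpace X] [MeasurableSpace X] {Φ : Flow ℝ X} {μ : Measure X}

/-- The Koopman operator `U^t f = f ∘ Φ^t` on `L²(μ)`. -/
def koopman (hΦ : IsErgodicFlow Φ μ) (t : ℝ) : Lp ℂ 2 μ →L[ℂ] Lp ℂ 2 μ :=
  (Lp.compMeasurePreservingₗᵢ ℂ (Φ t) (hΦ.measurePreserving t)).toContinuousLinearMap

/-- The projection `Π₊ = E(i(0,∞))` onto the positive-frequency subspace, where `E` is the
spectral measure of the generator of the Koopman group. -/
def posFreqProjection (hΦ : IsErgodicFlow Φ μ) : Lp ℂ 2 μ →L[ℂ] Lp ℂ 2 μ :=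
  skewSpectralProjection (generator (koopman hΦ)) (Ioi 0)

/-- The time domain `T_{m,n} = [-n²S/(m(2n+1)), n²S/(m(2n+1))]`. -/
def timeDomain (S : ℝ) (m n : ℕ) : Set ℝ :=
  Icc (-((n : ℝ) ^ 2 * S / ((m : ℝ) * (2 * (n : ℝ) + 1))))
    ((n : ℝ) ^ 2 * S / ((m : ℝ) * (2 * (n : ℝ) + 1)))

/-- The integrand `(ω, t) ↦ h_m(ω) χ_{T_{m,n}}(t) e^{-iωt} U^t f`. -/
def windowIntegrand (hΦ : IsErgodicFlow Φ μ) (S : ℝ) (h : ℕ → ℝ → ℝ) (m n : ℕ)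
    (f : Lp ℂ 2 μ) (p : ℝ × ℝ) : Lp ℂ 2 μ :=
  ((h m p.1 : ℂ) * (timeDomain S m n).indicator (fun _ => (1 : ℂ)) p.2 *
    Complex.exp (-(Complex.I * (p.1 : ℂ) * (p.2 : ℂ)))) • koopman hΦ p.2 f

/-- `P_{m,n} f = (1/2π) ∫_{ℝ²} h_m(ω) χ_{T_{m,n}}(t) e^{-iωt} U^t f d(ω,t)`. -/
def windowOperator (hΦ : IsErgodicFlow Φ μ) (S : ℝ) (h : ℕ → ℝ → ℝ) (m n : ℕ)
    (f : Lp ℂ 2 μ) : Lp ℂ 2 μ :=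
  ((1 / (2 * Real.pi) : ℝ) : ℂ) • ∫ p : ℝ × ℝ, windowIntegrand hΦ S h m n f p

end Koopman

end

/-! Let `E` be a spectral measure of the generator and `ν_f(s) = ‖E(s) f‖²`. Everything rests on the
formula `U^t f = (∫ e^{iωt} dE(ω)) f`. Granted this, Fubini turns `P_{m,n} f` into an integral over
`T_{m,n}` of `(1/2π) ĥ_m(t) U^t f`, where `ĥ_m(t) = ∫ h_m(ω) e^{-iωt} dω`. Since `h_m` is smooth
with compact support, `ĥ_m` is integrable, and `T_{m,n}` exhausts the line as `n → ∞`, so dominated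
convergence gives the full integral (`tendsto_windowOperator`). Fourier inversion identifies it with
`(∫ h_m dE) f` (`integral_windowTransform_smul`). As `m → ∞` the `h_m` converge boundedly and
pointwise to the indicator of `(0,∞)`, so dominated convergence in `L²(ν_f)` yields `E((0,∞)) f`.

The vectors `(∫ φ dE) f` are handled through the isometry `L²(ν_f) → H` with `χ_s ↦ E(s) f`
(`specInt`), which reduces limits in `H` to limits of scalar functions.

The positive-frequency projection is defined by choosing some spectral measure, so two facts are
needed. First, one exists: this is Stone's theorem (`isSpectralMeasureOf_generator`), proved from
Bochner's theorem for `t ↦ ⟪f, U^t f⟫`. Gaussian damping makes this function integrable with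
nonnegative Fourier transform, and a tightness argument removes the damping. Second, the formula for
`U^t` holds for every spectral measure of the generator (`apply_eq_specInt_freqExp`): on the domain
both sides solve `u' = V u` with the same initial value, and `V` is skew. -/

noncomputable section

/-! ### Functions as vectors of `L²` -/

section L2Class

variable {α : Type*} [MeasurableSpace α]

open Classical in
/-- The class in `L²(ν)` of a square-integrable function, and `0` for any other function. -/
def l2Class (ν : Measure α) (φ : α → ℂ) : Lp ℂ 2 ν :=
  if h : MemLp φ 2 ν then h.toLp φ else 0

variable {ν : Measure α} {φ ψ : α → ℂ}

theorem coeFn_l2Class (hφ : MemLp φ 2 ν) : l2Class ν φ =ᵐ[ν] φ := by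
  rw [l2Class, dif_pos hφ]
  exact hφ.coeFn_toLp

theorem l2Class_coeFn (k : Lp ℂ 2 ν) : l2Class ν k = k := by
  rw [l2Class, dif_pos (Lp.memLp k), Lp.toLp_coeFn]

theorem l2Class_add (hφ : MemLp φ 2 ν) (hψ : MemLp ψ 2 ν) :
    l2Class ν (fun x => φ x + ψ x) = l2Class ν φ + l2Class ν ψ := by
  have h : MemLp (fun x => φ x + ψ x) 2 ν := hφ.add hψ
  rw [l2Class, l2Class, l2Class, dif_pos h, dif_pos hφ, dif_pos hψ]
  exact MemLp.toLp_add hφ hψ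

theorem l2Class_sub (hφ : MemLp φ 2 ν) (hψ : MemLp ψ 2 ν) :
    l2Class ν (fun x => φ x - ψ x) = l2Class ν φ - l2Class ν ψ := by
  have h : MemLp (fun x => φ x - ψ x) 2 ν := hφ.sub hψ
  rw [l2Class, l2Class, l2Class, dif_pos h, dif_pos hφ, dif_pos hψ]
  exact MemLp.toLp_sub hφ hψ

theorem l2Class_const_mul (c : ℂ) (hφ : MemLp φ 2 ν) :
    l2Class ν (fun x => c * φ x) = c • l2Class ν φ := by
  have h : MemLp (fun x => c * φ x) 2 ν := hφ.const_mul c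
  rw [l2Class, l2Class, dif_pos h, dif_pos hφ]
  exact MemLp.toLp_const_smul c hφ

theorem l2Class_zero : l2Class ν (fun _ => 0) = 0 := by
  rw [l2Class, dif_pos MemLp.zero']
  exact MemLp.toLp_zero _

theorem l2Class_sum {ι : Type*} (s : Finset ι) {φ : ι → α → ℂ} (hφ : ∀ i, MemLp (φ i) 2 ν) :
    l2Class ν (fun x => ∑ i ∈ s, φ i x) = ∑ i ∈ s, l2Class ν (φ i) := by
  classical
  induction s using Finset.induction_on with
  | empty => simp [l2Class_zero]
  | insert a s ha ih =>
    simp_rw [Finset.sum_insert ha]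
    rw [l2Class_add (hφ a) (memLp_finsetSum s fun i _ => hφ i), ih]

theorem inner_l2Class (hφ : MemLp φ 2 ν) (hψ : MemLp ψ 2 ν) :
    ⟪l2Class ν φ, l2Class ν ψ⟫_ℂ = ∫ x, (starRingEnd ℂ) (φ x) * ψ x ∂ν := by
  rw [L2.inner_def]
  refine integral_congr_ae ?_
  filter_upwards [coeFn_l2Class hφ, coeFn_l2Class hψ] with x h1 h2
  rw [h1, h2, RCLike.inner_apply, mul_comm]

theorem norm_l2Class (hφ : MemLp φ 2 ν) : ‖l2Class ν φ‖ = (eLpNorm φ 2 ν).toReal := by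
  rw [l2Class, dif_pos hφ, Lp.norm_toLp]

theorem norm_sq_l2Class (hφ : MemLp φ 2 ν) : ‖l2Class ν φ‖ ^ 2 = ∫ x, ‖φ x‖ ^ 2 ∂ν := by
  have h := inner_l2Class hφ hφ
  rw [inner_self_eq_norm_sq_to_K] at h
  simp_rw [← Complex.normSq_eq_conj_mul_self, Complex.normSq_eq_norm_sq] at h
  rw [integral_complex_ofReal] at h
  exact Complex.ofReal_injective (by simpa using h)

theorem memLp_two_of_norm_le {C : ℝ} [IsFiniteMeasure ν] (hφ : AEStronglyMeasurable φ ν)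
    (hC : ∀ x, ‖φ x‖ ≤ C) : MemLp φ 2 ν :=
  MemLp.of_bound hφ C (Eventually.of_forall hC)

theorem memLp_two_of_lintegral_lt_top (hφ : AEStronglyMeasurable φ ν)
    (h : ∫⁻ x, ENNReal.ofReal (‖φ x‖ ^ 2) ∂ν < ∞) : MemLp φ 2 ν := by
  refine (memLp_two_iff_integrable_sq_norm hφ).2 ⟨(hφ.norm.pow 2), ?_⟩
  rw [hasFiniteIntegral_iff_norm]
  simpa using h

theorem MeasureTheory.MemLp.lintegral_norm_sq_lt_top (h : MemLp φ 2 ν) :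
    ∫⁻ x, ENNReal.ofReal (‖φ x‖ ^ 2) ∂ν < ∞ := by
  have h1 := ((memLp_two_iff_integrable_sq_norm h.1).1 h).2
  rw [hasFiniteIntegral_iff_norm] at h1
  simpa using h1

/-- Dominated convergence applied to `‖φ i - ψ‖²`. The general filter serves sequences, punctured
neighbourhoods of a time, and the directed set of finite subsets of `ℕ`. -/
theorem tendsto_l2Class_of_dominated {ι : Type*} {l : Filter ι} [l.IsCountablyGenerated]
    {φ : ι → α → ℂ} {ψ : α → ℂ} {G : α → ℝ} (hφ : ∀ i, AEStronglyMeasurable (φ i) ν)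
    (hψ : AEStronglyMeasurable ψ ν)
    (hG : MemLp G 2 ν) (hle : ∀ᶠ i in l, ∀ x, ‖φ i x‖ ≤ G x) (hψG : ∀ x, ‖ψ x‖ ≤ G x)
    (hlim : ∀ x, Tendsto (fun i => φ i x) l (𝓝 (ψ x))) :
    Tendsto (fun i => l2Class ν (φ i)) l (𝓝 (l2Class ν ψ)) := by
  have hψ2 : MemLp ψ 2 ν := hG.mono hψ (Eventually.of_forall fun x =>
    (hψG x).trans (le_abs_self _))
  rw [tendsto_iff_norm_sub_tendsto_zero]
  have key : Tendsto (fun i => ∫ x, ‖φ i x - ψ x‖ ^ 2 ∂ν) l (𝓝 (∫ _, 0 ∂ν)) := by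
    refine tendsto_integral_filter_of_dominated_convergence (fun x => (2 * G x) ^ 2)
      (Eventually.of_forall fun i => ((hφ i).sub hψ).norm.pow 2) ?_ ?_ ?_
    · filter_upwards [hle] with i hi
      refine Eventually.of_forall fun x => ?_
      rw [Real.norm_eq_abs, abs_of_nonneg (by positivity)]
      have : ‖φ i x - ψ x‖ ≤ 2 * G x := by
        linarith [norm_sub_le (φ i x) (ψ x), hi x, hψG x]
      gcongr
    · exact (hG.const_mul 2).integrable_sq
    · refine Eventually.of_forall fun x => ?_
      have := (((hlim x).sub_const (ψ x)).norm).pow 2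
      simpa using this
  rw [integral_zero] at key
  have key2 := (Real.continuous_sqrt.tendsto 0).comp key
  rw [Real.sqrt_zero] at key2
  refine key2.congr' ?_
  filter_upwards [hle] with i hi
  have hi2 : MemLp (φ i) 2 ν := hG.mono (hφ i) (Eventually.of_forall fun x =>
    (hi x).trans (le_abs_self _))
  have h := norm_sq_l2Class (hi2.sub hψ2)
  rw [← l2Class_sub hi2 hψ2]
  simp only [Function.comp]
  simp only [Pi.sub_apply] at h
  rw [← h]
  exact Real.sqrt_sq (norm_nonneg _)

theorem memLp_simpleFunc (ν : Measure α) [IsFiniteMeasure ν] (s : SimpleFunc α ℂ) :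
    MemLp s 2 ν := s.memLp_of_isFiniteMeasure 2 ν

/-- The approximating sequence does not depend on a measure, so one sequence can be used in several
`L²` spaces at once. -/
theorem exists_simpleFunc_tendsto (hφ : Measurable φ) :
    ∃ s : ℕ → SimpleFunc α ℂ, (∀ x, Tendsto (fun n => s n x) atTop (𝓝 (φ x))) ∧
      ∀ n x, ‖s n x‖ ≤ 2 * ‖φ x‖ := by
  refine ⟨fun n => SimpleFunc.approxOn φ hφ univ 0 (mem_univ 0) n, fun x => ?_, fun n x => ?_⟩
  · exact SimpleFunc.tendsto_approxOn hφ (mem_univ 0) (by simp)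
  · rw [two_mul]
    exact SimpleFunc.norm_approxOn_zero_le hφ (mem_univ 0) x n

/-- Pointwise dominated approximation by simple functions converges in `L²`. -/
theorem tendsto_l2Class_of_simpleFunc {s : ℕ → SimpleFunc α ℂ} (hφm : Measurable φ)
    (hφ : MemLp φ 2 ν) (hs : ∀ x, Tendsto (fun n => s n x) atTop (𝓝 (φ x)))
    (hle : ∀ n x, ‖s n x‖ ≤ 2 * ‖φ x‖) :
    Tendsto (fun n => l2Class ν (s n)) atTop (𝓝 (l2Class ν φ)) :=
  tendsto_l2Class_of_dominated (G := fun x => 2 * ‖φ x‖)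
    (fun n => (s n).measurable.aestronglyMeasurable) hφm.aestronglyMeasurable
    (hφ.norm.const_mul 2) (Eventually.of_forall hle)
    (fun x => by linarith [norm_nonneg (φ x)]) hs

end L2Class

/-- A family of vectors with the Gram matrix of a total family is its image under an isometry. -/
theorem exists_linearIsometry_of_inner_eq {ι K H : Type*}
    [NormedAddCommGroup K] [InnerProductSpace ℂ K]
    [NormedAddCommGroup H] [InnerProductSpace ℂ H] [CompleteSpace H] (e : ι → K) (v : ι → H)
    (hd : (Submodule.span ℂ (range e)).topologicalClosure = ⊤)
    (h : ∀ i j, ⟪v i, v j⟫_ℂ = ⟪e i, e j⟫_ℂ) :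
    ∃ J : K →ₗᵢ[ℂ] H, ∀ i, J (e i) = v i := by
  -- Working on the free module avoids choosing representatives: equal Gram matrices give equal
  -- norms of the two combinations, hence well-definedness and boundedness together.
  let Te := Finsupp.linearCombination ℂ e
  let Tv := Finsupp.linearCombination ℂ v
  have hn : ∀ x, ‖Tv x‖ = ‖Te x‖ := by
    intro x
    have h2 : ⟪Tv x, Tv x⟫_ℂ = ⟪Te x, Te x⟫_ℂ := by
      simp only [Tv, Te, Finsupp.linearCombination_apply, Finsupp.sum_inner, Finsupp.inner_sum,
        inner_smul_left, inner_smul_right, h]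
    rw [← sq_eq_sq₀ (norm_nonneg _) (norm_nonneg _)]
    rw [inner_self_eq_norm_sq_to_K, inner_self_eq_norm_sq_to_K] at h2
    exact_mod_cast h2
  have hdense : DenseRange Te := by
    have : range Te = (Submodule.span ℂ (range e) : Set K) := by
      rw [← Finsupp.range_linearCombination]; rfl
    rw [DenseRange, this]
    exact Submodule.dense_iff_topologicalClosure_eq_top.2 hd
  have hbd : ∃ C, ∀ x, ‖Tv x‖ ≤ C * ‖Te x‖ := ⟨1, fun x => by rw [hn, one_mul]⟩
  let J := Tv.extendOfNorm Te
  have hJ : ∀ x, J (Te x) = Tv x := LinearMap.extendOfNorm_eq hdense hbd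
  have hJn : ∀ y, ‖J y‖ = ‖y‖ := fun y =>
    hdense.induction_on (p := fun y => ‖J y‖ = ‖y‖) y
      (isClosed_eq (J.continuous.norm) continuous_norm) fun x => by rw [hJ, hn]
  refine ⟨⟨J.toLinearMap, hJn⟩, fun i => ?_⟩
  have := hJ (Finsupp.single i 1)
  simpa [Te, Tv] using this

/-- Measurable indicators span a dense subspace of `L²`. -/
theorem span_l2Class_indicator_dense {α : Type*} [MeasurableSpace α] (ν : Measure α)
    [IsFiniteMeasure ν] :
    (Submodule.span ℂ (range fun s : {s : Set α // MeasurableSet s} =>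
      l2Class ν ((s : Set α).indicator fun _ => (1 : ℂ)))).topologicalClosure = ⊤ := by
  rw [eq_top_iff]
  rintro k -
  set W := (Submodule.span ℂ (range fun s : {s : Set α // MeasurableSet s} =>
      l2Class ν ((s : Set α).indicator fun _ => (1 : ℂ))))
  have hsimple : ∀ s : SimpleFunc α ℂ, l2Class ν s ∈ W := by
    intro s
    induction s using SimpleFunc.induction with
    | const c hs =>
      have h1 : MemLp ((_ : Set α).indicator fun _ => (1 : ℂ)) 2 ν :=
        memLp_indicator_const 2 hs 1 (Or.inr (measure_ne_top _ _))
      have := l2Class_const_mul c h1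
      have h2 := W.smul_mem c (Submodule.subset_span ⟨⟨_, hs⟩, rfl⟩)
      rw [← this] at h2
      convert h2 using 2
      ext x
      simp only [SimpleFunc.coe_piecewise, SimpleFunc.coe_const, Set.indicator, Set.piecewise]
      split_ifs <;> simp
    | @add s₁ s₂ hd hf hg =>
      have := l2Class_add (memLp_simpleFunc ν s₁) (memLp_simpleFunc ν s₂)
      have h2 := W.add_mem hf hg
      rw [← this] at h2
      exact h2
  have hk : Measurable (k : α → ℂ) := (Lp.stronglyMeasurable k).measurable
  obtain ⟨s, hs, hle⟩ := exists_simpleFunc_tendsto hk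
  have := tendsto_l2Class_of_simpleFunc hk (Lp.memLp k) hs hle
  rw [l2Class_coeFn] at this
  exact mem_closure_of_tendsto this (Eventually.of_forall fun n => hsimple (s n))

/-! ### Spectral integrals of a projection-valued measure -/

namespace ProjectionValuedMeasure

variable {α : Type*} [MeasurableSpace α] {H : Type*}
  [NormedAddCommGroup H] [InnerProductSpace ℂ H] [CompleteSpace H]
  (E : ProjectionValuedMeasure α H)

theorem scalarMeasure_apply (f : H) {s : Set α} (hs : MeasurableSet s) :
    E.scalarMeasure f s = ENNReal.ofReal (‖E.proj s f‖ ^ 2) := by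
  rw [scalarMeasure, Measure.ofMeasurable_apply s hs, E.re_inner_proj hs]

instance isFiniteMeasure_scalarMeasure (f : H) : IsFiniteMeasure (E.scalarMeasure f) :=
  ⟨by rw [E.scalarMeasure_apply f MeasurableSet.univ]; exact ENNReal.ofReal_lt_top⟩

theorem scalarMeasure_real (f : H) {s : Set α} (hs : MeasurableSet s) :
    (E.scalarMeasure f).real s = ‖E.proj s f‖ ^ 2 := by
  rw [Measure.real, E.scalarMeasure_apply f hs, ENNReal.toReal_ofReal (by positivity)]

theorem proj_proj {s t : Set α} (hs : MeasurableSet s) (ht : MeasurableSet t) (f : H) :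
    E.proj s (E.proj t f) = E.proj (s ∩ t) f := by
  rw [E.proj_inter s t hs ht]; rfl

theorem inner_proj_left {s : Set α} (hs : MeasurableSet s) (f g : H) :
    ⟪E.proj s f, g⟫_ℂ = ⟪f, E.proj s g⟫_ℂ := by
  have hadj : ContinuousLinearMap.adjoint (E.proj s) = E.proj s :=
    (E.isStarProjection s hs).isSelfAdjoint.star_eq
  rw [← ContinuousLinearMap.adjoint_inner_left, hadj]

theorem inner_self_proj {s : Set α} (hs : MeasurableSet s) (f : H) :
    ⟪f, E.proj s f⟫_ℂ = ((E.scalarMeasure f).real s : ℂ) := by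
  have h1 : E.proj s (E.proj s f) = E.proj s f := by rw [E.proj_proj hs hs, inter_self]
  rw [← h1, ← E.inner_proj_left hs, inner_self_eq_norm_sq_to_K, E.scalarMeasure_real f hs]
  simp

theorem inner_proj_proj {s t : Set α} (hs : MeasurableSet s) (ht : MeasurableSet t) (f : H) :
    ⟪E.proj s f, E.proj t f⟫_ℂ = ((E.scalarMeasure f).real (s ∩ t) : ℂ) := by
  rw [E.inner_proj_left hs, E.proj_proj hs ht, E.inner_self_proj (hs.inter ht)]

theorem memLp_indicator_one {ν : Measure α} [IsFiniteMeasure ν] {s : Set α}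
    (hs : MeasurableSet s) : MemLp (s.indicator fun _ => (1 : ℂ)) 2 ν :=
  memLp_indicator_const 2 hs 1 (Or.inr (measure_ne_top _ _))

/-- Both families have the Gram matrix `ν_f(s ∩ t)`. -/
theorem exists_isometry (f : H) : ∃ J : Lp ℂ 2 (E.scalarMeasure f) →ₗᵢ[ℂ] H,
    ∀ s : {s : Set α // MeasurableSet s},
      J (l2Class (E.scalarMeasure f) ((s : Set α).indicator fun _ => (1 : ℂ))) = E.proj s f := by
  refine exists_linearIsometry_of_inner_eq _ _ (span_l2Class_indicator_dense _) ?_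
  rintro ⟨s, hs⟩ ⟨t, ht⟩
  rw [E.inner_proj_proj hs ht, inner_l2Class (memLp_indicator_one hs) (memLp_indicator_one ht)]
  have : (fun x => (starRingEnd ℂ) (s.indicator (fun _ => (1 : ℂ)) x) *
      t.indicator (fun _ => (1 : ℂ)) x) = (s ∩ t).indicator fun _ => (1 : ℂ) := by
    ext x
    by_cases h1 : x ∈ s <;> by_cases h2 : x ∈ t <;> simp [h1, h2]
  rw [this, integral_indicator_const _ (hs.inter ht)]
  simp

/-- The isometric embedding of `L²(ν_f)` that sends indicators `χ_s` to `E(s) f`. -/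
def isometry (f : H) : Lp ℂ 2 (E.scalarMeasure f) →ₗᵢ[ℂ] H := (E.exists_isometry f).choose

/-- The vector `(∫ φ dE) f`, for `φ ∈ L²(ν_f)`. -/
def specInt (f : H) (φ : α → ℂ) : H := E.isometry f (l2Class (E.scalarMeasure f) φ)

variable {f g : H} {φ ψ k : α → ℂ}

theorem specInt_indicator (f : H) {s : Set α} (hs : MeasurableSet s) :
    E.specInt f (s.indicator fun _ => 1) = E.proj s f :=
  (E.exists_isometry f).choose_spec ⟨s, hs⟩

theorem specInt_one (f : H) : E.specInt f (fun _ => 1) = f := by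
  have := E.specInt_indicator f MeasurableSet.univ
  rw [indicator_univ, E.proj_univ] at this
  exact this

theorem specInt_add (hφ : MemLp φ 2 (E.scalarMeasure f)) (hψ : MemLp ψ 2 (E.scalarMeasure f)) :
    E.specInt f (fun x => φ x + ψ x) = E.specInt f φ + E.specInt f ψ := by
  rw [specInt, l2Class_add hφ hψ, map_add]; rfl

theorem specInt_sub (hφ : MemLp φ 2 (E.scalarMeasure f)) (hψ : MemLp ψ 2 (E.scalarMeasure f)) :
    E.specInt f (fun x => φ x - ψ x) = E.specInt f φ - E.specInt f ψ := by
  rw [specInt, l2Class_sub hφ hψ, map_sub]; rfl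

theorem specInt_const_mul (c : ℂ) (hφ : MemLp φ 2 (E.scalarMeasure f)) :
    E.specInt f (fun x => c * φ x) = c • E.specInt f φ := by
  rw [specInt, l2Class_const_mul c hφ, map_smul]; rfl

theorem inner_specInt (hφ : MemLp φ 2 (E.scalarMeasure f)) (hψ : MemLp ψ 2 (E.scalarMeasure f)) :
    ⟪E.specInt f φ, E.specInt f ψ⟫_ℂ =
      ∫ x, (starRingEnd ℂ) (φ x) * ψ x ∂(E.scalarMeasure f) := by
  rw [specInt, specInt, LinearIsometry.inner_map_map, inner_l2Class hφ hψ]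

theorem inner_self_specInt (hψ : MemLp ψ 2 (E.scalarMeasure f)) :
    ⟪f, E.specInt f ψ⟫_ℂ = ∫ x, ψ x ∂(E.scalarMeasure f) := by
  have := E.inner_specInt (f := f) (φ := fun _ => 1) (memLp_const 1) hψ
  rw [specInt_one] at this
  simpa using this

theorem norm_sq_specInt (hφ : MemLp φ 2 (E.scalarMeasure f)) :
    ‖E.specInt f φ‖ ^ 2 = ∫ x, ‖φ x‖ ^ 2 ∂(E.scalarMeasure f) := by
  rw [specInt, LinearIsometry.norm_map, norm_sq_l2Class hφ]

theorem tendsto_specInt_of_dominated {ι : Type*} {l : Filter ι} [l.IsCountablyGenerated]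
    {φ : ι → α → ℂ} {G : α → ℝ} (hφ : ∀ i, Measurable (φ i)) (hψ : Measurable ψ)
    (hG : MemLp G 2 (E.scalarMeasure f)) (hle : ∀ᶠ i in l, ∀ x, ‖φ i x‖ ≤ G x)
    (hψG : ∀ x, ‖ψ x‖ ≤ G x) (hlim : ∀ x, Tendsto (fun i => φ i x) l (𝓝 (ψ x))) :
    Tendsto (fun i => E.specInt f (φ i)) l (𝓝 (E.specInt f ψ)) :=
  ((E.isometry f).continuous.tendsto _).comp (tendsto_l2Class_of_dominated
    (fun i => (hφ i).aestronglyMeasurable) hψ.aestronglyMeasurable hG hle hψG hlim)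

theorem tendsto_specInt_of_simpleFunc {s : ℕ → SimpleFunc α ℂ} (hφm : Measurable φ)
    (hφ : MemLp φ 2 (E.scalarMeasure f)) (hs : ∀ x, Tendsto (fun n => s n x) atTop (𝓝 (φ x)))
    (hle : ∀ n x, ‖s n x‖ ≤ 2 * ‖φ x‖) :
    Tendsto (fun n => E.specInt f (s n)) atTop (𝓝 (E.specInt f φ)) :=
  ((E.isometry f).continuous.tendsto _).comp (tendsto_l2Class_of_simpleFunc hφm hφ hs hle)

theorem specInt_piecewise_const (f : H) (c : ℂ) {s : Set α} (hs : MeasurableSet s) :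
    E.specInt f (SimpleFunc.piecewise s hs (SimpleFunc.const α c) (SimpleFunc.const α 0)) =
      c • E.proj s f := by
  rw [← E.specInt_indicator f hs, ← E.specInt_const_mul c (memLp_indicator_one hs)]
  congr 1
  ext x
  by_cases hx : x ∈ s <;> simp [hx]

theorem specInt_simpleFunc_add (f : H) (s t : SimpleFunc α ℂ) :
    E.specInt f (s + t : SimpleFunc α ℂ) = E.specInt f s + E.specInt f t :=
  E.specInt_add (memLp_simpleFunc _ s) (memLp_simpleFunc _ t)

/-- This is the parallelogram law. It transfers square-integrability from two vectors to their sum.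
-/
theorem scalarMeasure_add_le (f g : H) :
    E.scalarMeasure (f + g) ≤ (2 : ℝ≥0∞) • (E.scalarMeasure f + E.scalarMeasure g) := by
  refine Measure.le_intro fun s hs _ => ?_
  rw [Measure.smul_apply, Measure.add_apply, E.scalarMeasure_apply _ hs, E.scalarMeasure_apply _ hs,
    E.scalarMeasure_apply _ hs, ← ENNReal.ofReal_add (by positivity) (by positivity), smul_eq_mul,
    ← ENNReal.ofReal_ofNat, ← ENNReal.ofReal_mul (by norm_num)]
  refine ENNReal.ofReal_le_ofReal ?_
  rw [map_add]
  nlinarith [parallelogram_law_with_norm ℂ (E.proj s f) (E.proj s g),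
    sq_nonneg ‖E.proj s f - E.proj s g‖]

theorem memLp_scalarMeasure_add (hφm : Measurable φ) (hf : MemLp φ 2 (E.scalarMeasure f))
    (hg : MemLp φ 2 (E.scalarMeasure g)) : MemLp φ 2 (E.scalarMeasure (f + g)) := by
  refine memLp_two_of_lintegral_lt_top hφm.aestronglyMeasurable ?_
  refine (lintegral_mono' (E.scalarMeasure_add_le f g) le_rfl).trans_lt ?_
  rw [lintegral_smul_measure, lintegral_add_measure]
  exact ENNReal.mul_lt_top (by norm_num)
    (ENNReal.add_lt_top.2 ⟨hf.lintegral_norm_sq_lt_top, hg.lintegral_norm_sq_lt_top⟩)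

/-- The three terms come from isometries on different `L²` spaces. For simple functions all are
combinations of projections, which are linear in the vector; the general case is a common limit. -/
theorem specInt_vec_add (hφm : Measurable φ) (hf : MemLp φ 2 (E.scalarMeasure f))
    (hg : MemLp φ 2 (E.scalarMeasure g)) :
    E.specInt (f + g) φ = E.specInt f φ + E.specInt g φ := by
  have hsimple : ∀ s : SimpleFunc α ℂ, E.specInt (f + g) s = E.specInt f s + E.specInt g s := by
    intro s
    induction s using SimpleFunc.induction with
    | const c hs => simp_rw [specInt_piecewise_const, map_add, smul_add]
    | @add s t hd hs ht =>
      rw [specInt_simpleFunc_add, specInt_simpleFunc_add, specInt_simpleFunc_add, hs, ht]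
      abel
  obtain ⟨s, hs, hle⟩ := exists_simpleFunc_tendsto hφm
  refine tendsto_nhds_unique (E.tendsto_specInt_of_simpleFunc hφm
    (E.memLp_scalarMeasure_add hφm hf hg) hs hle) ?_
  simp_rw [hsimple]
  exact (E.tendsto_specInt_of_simpleFunc hφm hf hs hle).add
    (E.tendsto_specInt_of_simpleFunc hφm hg hs hle)

theorem scalarMeasure_smul (c : ℂ) (f : H) :
    E.scalarMeasure (c • f) = ENNReal.ofReal (‖c‖ ^ 2) • E.scalarMeasure f := by
  ext s hs
  rw [Measure.smul_apply, E.scalarMeasure_apply _ hs, E.scalarMeasure_apply _ hs, smul_eq_mul,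
    ← ENNReal.ofReal_mul (by positivity), map_smul, norm_smul, mul_pow]

theorem memLp_scalarMeasure_smul (c : ℂ) (hφ : MemLp φ 2 (E.scalarMeasure f)) :
    MemLp φ 2 (E.scalarMeasure (c • f)) := by
  rw [scalarMeasure_smul]
  exact hφ.smul_measure ENNReal.ofReal_ne_top

theorem specInt_vec_smul (c : ℂ) (hφm : Measurable φ) (hφ : MemLp φ 2 (E.scalarMeasure f)) :
    E.specInt (c • f) φ = c • E.specInt f φ := by
  have hsimple : ∀ s : SimpleFunc α ℂ, E.specInt (c • f) s = c • E.specInt f s := by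
    intro s
    induction s using SimpleFunc.induction with
    | const d hs => simp_rw [specInt_piecewise_const, map_smul, smul_comm c d]
    | @add s t hd hs ht =>
      rw [specInt_simpleFunc_add, specInt_simpleFunc_add, hs, ht, smul_add]
  obtain ⟨s, hs, hle⟩ := exists_simpleFunc_tendsto hφm
  refine tendsto_nhds_unique (E.tendsto_specInt_of_simpleFunc hφm
    (E.memLp_scalarMeasure_smul c hφ) hs hle) ?_
  simp_rw [hsimple]
  exact (E.tendsto_specInt_of_simpleFunc hφm hφ hs hle).const_smul c

theorem specInt_vec_sub (hφm : Measurable φ) (hf : MemLp φ 2 (E.scalarMeasure f))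
    (hg : MemLp φ 2 (E.scalarMeasure g)) :
    E.specInt (f - g) φ = E.specInt f φ - E.specInt g φ := by
  rw [sub_eq_add_neg f g, ← neg_one_smul ℂ g,
    E.specInt_vec_add hφm hf (E.memLp_scalarMeasure_smul _ hg), E.specInt_vec_smul _ hφm hg,
    neg_one_smul, sub_eq_add_neg]

theorem proj_specInt {t : Set α} (ht : MeasurableSet t) (hφm : Measurable φ)
    (hφ : MemLp φ 2 (E.scalarMeasure f)) :
    E.proj t (E.specInt f φ) = E.specInt f (t.indicator φ) := by
  have hsimple : ∀ s : SimpleFunc α ℂ, E.proj t (E.specInt f s) = E.specInt f (t.indicator s) := by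
    intro s
    induction s using SimpleFunc.induction with
    | @const c s hs =>
      rw [specInt_piecewise_const, map_smul, E.proj_proj ht hs,
        ← E.specInt_piecewise_const f c (ht.inter hs)]
      congr 1
      ext x
      by_cases h1 : x ∈ s <;> by_cases h2 : x ∈ t <;> simp [h1, h2]
    | @add s₁ s₂ hd h1 h2 =>
      rw [specInt_simpleFunc_add, map_add, h1, h2, ← E.specInt_add
        ((memLp_simpleFunc _ s₁).indicator ht) ((memLp_simpleFunc _ s₂).indicator ht)]
      congr 1
      ext x
      by_cases h2 : x ∈ t <;> simp [h2]
  obtain ⟨s, hs, hle⟩ := exists_simpleFunc_tendsto hφm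
  refine tendsto_nhds_unique (((E.proj t).continuous.tendsto _).comp
    (E.tendsto_specInt_of_simpleFunc hφm hφ hs hle)) ?_
  simp only [Function.comp_def, hsimple]
  refine E.tendsto_specInt_of_dominated (G := fun x => 2 * ‖φ x‖)
    (fun n => (s n).measurable.indicator ht) (hφm.indicator ht) (hφ.norm.const_mul 2)
    (Eventually.of_forall fun n x => ?_) (fun x => ?_) fun x => ?_
  · exact (norm_indicator_le_norm_self _ _).trans (hle n x)
  · exact (norm_indicator_le_norm_self _ _).trans (by linarith [norm_nonneg (φ x)])
  · by_cases hx : x ∈ t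
    · simpa [hx] using hs x
    · simp [hx]

theorem scalarMeasure_specInt (hk : Measurable k) (hk2 : MemLp k 2 (E.scalarMeasure f)) :
    E.scalarMeasure (E.specInt f k) =
      (E.scalarMeasure f).withDensity fun x => ENNReal.ofReal (‖k x‖ ^ 2) := by
  ext s hs
  rw [E.scalarMeasure_apply _ hs, withDensity_apply _ hs, E.proj_specInt hs hk hk2,
    E.norm_sq_specInt (hk2.indicator hs), ← ofReal_integral_eq_lintegral_ofReal,
    ← integral_indicator hs]
  · congr 2
    ext x
    by_cases hx : x ∈ s <;> simp [hx]
  · exact ((memLp_two_iff_integrable_sq_norm hk2.1).1 hk2).integrableOn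
  · exact Eventually.of_forall fun x => by positivity

theorem memLp_scalarMeasure_specInt (hk : Measurable k) (hk2 : MemLp k 2 (E.scalarMeasure f))
    (hφ : Measurable φ) (h : MemLp (fun x => φ x * k x) 2 (E.scalarMeasure f)) :
    MemLp φ 2 (E.scalarMeasure (E.specInt f k)) := by
  refine memLp_two_of_lintegral_lt_top hφ.aestronglyMeasurable ?_
  rw [E.scalarMeasure_specInt hk hk2, lintegral_withDensity_eq_lintegral_mul _ (by fun_prop)
    (by fun_prop)]
  convert h.lintegral_norm_sq_lt_top using 3 with x
  rw [Pi.mul_apply, ← ENNReal.ofReal_mul (by positivity), norm_mul, mul_pow, mul_comm]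

/-- Multiplicativity of the functional calculus. Only `k` and the product must be square-integrable,
so the unbounded function `φ = iω` is allowed. -/
theorem specInt_specInt (hk : Measurable k) (hk2 : MemLp k 2 (E.scalarMeasure f))
    (hφ : Measurable φ) (h : MemLp (fun x => φ x * k x) 2 (E.scalarMeasure f)) :
    E.specInt (E.specInt f k) φ = E.specInt f (fun x => φ x * k x) := by
  have hmul : ∀ s : SimpleFunc α ℂ, MemLp (fun x => s x * k x) 2 (E.scalarMeasure f) := by
    intro s
    obtain ⟨C, hC⟩ := s.exists_forall_norm_le
    exact MemLp.of_le_mul (c := C) hk2 (s.measurable.mul hk).aestronglyMeasurable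
      (Eventually.of_forall fun x => by rw [norm_mul]; gcongr; exact hC x)
  have hsimple : ∀ s : SimpleFunc α ℂ,
      E.specInt (E.specInt f k) s = E.specInt f (fun x => s x * k x) := by
    intro s
    induction s using SimpleFunc.induction with
    | @const c s hs =>
      rw [specInt_piecewise_const, E.proj_specInt hs hk hk2,
        ← E.specInt_const_mul c (hk2.indicator hs)]
      congr 1
      ext x
      by_cases h1 : x ∈ s <;> simp [h1]
    | @add s t hd hs ht =>
      rw [specInt_simpleFunc_add, hs, ht, ← E.specInt_add (hmul s) (hmul t)]
      congr 1
      ext x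
      simp [add_mul]
  obtain ⟨s, hs, hle⟩ := exists_simpleFunc_tendsto hφ
  refine tendsto_nhds_unique (E.tendsto_specInt_of_simpleFunc hφ
    (E.memLp_scalarMeasure_specInt hk hk2 hφ h) hs hle) ?_
  simp_rw [hsimple]
  refine E.tendsto_specInt_of_dominated (G := fun x => 2 * ‖φ x * k x‖)
    (fun n => (s n).measurable.mul hk) (hφ.mul hk) (h.norm.const_mul 2)
    (Eventually.of_forall fun n x => ?_) (fun x => ?_) fun x => (hs x).mul_const _
  · rw [norm_mul, norm_mul, ← mul_assoc]
    gcongr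
    exact hle n x
  · linarith [norm_nonneg (φ x * k x)]

end ProjectionValuedMeasure

/-! ### Characters of the real line -/

/-- The character `ω ↦ e^{iωt}`. -/
def freqExp (t ω : ℝ) : ℂ := Complex.exp (t * ω * Complex.I)

theorem freqExp_zero (ω : ℝ) : freqExp 0 ω = 1 := by simp [freqExp]

theorem freqExp_add (s t ω : ℝ) : freqExp (s + t) ω = freqExp s ω * freqExp t ω := by
  rw [freqExp, freqExp, freqExp, ← Complex.exp_add]
  congr 1
  push_cast
  ring

theorem norm_freqExp (t ω : ℝ) : ‖freqExp t ω‖ = 1 := by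
  rw [freqExp, ← Complex.ofReal_mul, Complex.norm_exp_ofReal_mul_I]

theorem conj_freqExp (t ω : ℝ) : (starRingEnd ℂ) (freqExp t ω) = freqExp (-t) ω := by
  rw [freqExp, freqExp, ← Complex.exp_conj]
  simp

theorem continuous_freqExp_uncurry : Continuous fun p : ℝ × ℝ => freqExp p.1 p.2 := by
  unfold freqExp
  fun_prop

theorem continuous_freqExp (t : ℝ) : Continuous (freqExp t) :=
  continuous_freqExp_uncurry.comp (by fun_prop : Continuous fun ω : ℝ => (t, ω))

theorem continuous_freqExp_left (ω : ℝ) : Continuous fun t => freqExp t ω :=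
  continuous_freqExp_uncurry.comp (by fun_prop : Continuous fun t : ℝ => (t, ω))

theorem measurable_freqExp (t : ℝ) : Measurable (freqExp t) := (continuous_freqExp t).measurable

theorem memLp_freqExp (ν : Measure ℝ) [IsFiniteMeasure ν] (t : ℝ) : MemLp (freqExp t) 2 ν :=
  memLp_two_of_norm_le (measurable_freqExp t).aestronglyMeasurable fun ω => (norm_freqExp t ω).le

theorem norm_freqExp_sub_one_le (t ω : ℝ) : ‖freqExp t ω - 1‖ ≤ |t| * |ω| := by
  have := Real.norm_exp_I_mul_ofReal_sub_one_le (x := t * ω)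
  rw [Real.norm_eq_abs, abs_mul, mul_comm Complex.I, Complex.ofReal_mul] at this
  exact this

theorem hasDerivAt_freqExp (t ω : ℝ) :
    HasDerivAt (fun t => freqExp t ω) (Complex.I * ω * freqExp t ω) t := by
  have h1 : HasDerivAt (fun t : ℝ => (t : ℂ) * ω * Complex.I) (1 * ω * Complex.I) t :=
    (((hasDerivAt_id t).ofReal_comp).mul_const _).mul_const _
  convert! h1.cexp using 1
  rw [freqExp]
  ring

/-- A bound independent of `h`: it dominates the difference quotients when differentiating under the
spectral integral. -/
theorem norm_freqExp_slope_le (t h ω : ℝ) :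
    ‖((h⁻¹ : ℝ) : ℂ) * (freqExp (t + h) ω - freqExp t ω)‖ ≤ ‖Complex.I * (ω : ℂ)‖ := by
  rw [freqExp_add, ← mul_sub_one, norm_mul, norm_mul, norm_freqExp, one_mul, norm_mul,
    Complex.norm_I, one_mul, Complex.norm_real, Complex.norm_real, Real.norm_eq_abs,
    Real.norm_eq_abs]
  -- At `h = 0` the left side vanishes, because `0⁻¹ = 0`.
  rcases eq_or_ne h 0 with rfl | hh
  · simp
  · calc |h⁻¹| * ‖freqExp h ω - 1‖ ≤ |h⁻¹| * (|h| * |ω|) := by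
          gcongr; exact norm_freqExp_sub_one_le h ω
      _ = |ω| := by rw [← mul_assoc, ← abs_mul, inv_mul_cancel₀ hh, abs_one, one_mul]

theorem tendsto_freqExp_slope (t ω : ℝ) :
    Tendsto (fun h : ℝ => ((h⁻¹ : ℝ) : ℂ) * (freqExp (t + h) ω - freqExp t ω)) (𝓝[≠] 0)
      (𝓝 (Complex.I * ω * freqExp t ω)) := by
  simpa using hasDerivAt_iff_tendsto_slope_zero.1 (hasDerivAt_freqExp t ω)

theorem measurable_freq : Measurable fun ω : ℝ => Complex.I * (ω : ℂ) := by fun_prop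

theorem tendsto_l2Class_freqExp_slope {ν : Measure ℝ}
    (hν : MemLp (fun ω : ℝ => Complex.I * (ω : ℂ)) 2 ν) (t : ℝ) :
    Tendsto (fun h : ℝ => l2Class ν fun ω =>
        ((h⁻¹ : ℝ) : ℂ) * (freqExp (t + h) ω - freqExp t ω)) (𝓝[≠] 0)
      (𝓝 (l2Class ν fun ω => Complex.I * ω * freqExp t ω)) := by
  refine tendsto_l2Class_of_dominated (G := fun ω : ℝ => ‖Complex.I * (ω : ℂ)‖) (fun h => ?_) ?_
    hν.norm (Eventually.of_forall fun h ω => norm_freqExp_slope_le t h ω)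
    (fun ω => ?_) fun ω => tendsto_freqExp_slope t ω
  · exact ((((measurable_freqExp _).sub (measurable_freqExp _))).const_mul _).aestronglyMeasurable
  · exact (measurable_freq.mul (measurable_freqExp t)).aestronglyMeasurable
  · rw [norm_mul _ (freqExp t ω), norm_freqExp, mul_one]

/-! ### Unitary groups and their generators -/

section UnitaryGroup

variable {H : Type*} [NormedAddCommGroup H] [InnerProductSpace ℂ H]

/-- A strongly continuous one-parameter unitary group. -/
structure IsUnitaryGroup (U : ℝ → H →L[ℂ] H) : Prop where
  map_zero : ∀ f, U 0 f = f
  map_add : ∀ s t f, U (s + t) f = U s (U t f)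
  norm_map : ∀ t f, ‖U t f‖ = ‖f‖
  continuous_apply : ∀ f, Continuous fun t => U t f

theorem generator_apply {U : ℝ → H →L[ℂ] H} {f g : H} (h : HasGeneratorAt U f g)
    (hf : f ∈ (generator U).domain) : generator U ⟨f, hf⟩ = g :=
  tendsto_nhds_unique (Exists.choose_spec hf) h

theorem hasGeneratorAt_generator {U : ℝ → H →L[ℂ] H} (f : (generator U).domain) :
    HasGeneratorAt U (f : H) (generator U f) := f.2.choose_spec

namespace IsUnitaryGroup

variable {U : ℝ → H →L[ℂ] H}

theorem inner_map_map (hU : IsUnitaryGroup U) (t : ℝ) (f g : H) : ⟪U t f, U t g⟫_ℂ = ⟪f, g⟫_ℂ :=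
  LinearIsometry.inner_map_map (⟨(U t).toLinearMap, hU.norm_map t⟩ : H →ₗᵢ[ℂ] H) f g

theorem inner_apply_left (hU : IsUnitaryGroup U) (t : ℝ) (f g : H) :
    ⟪U t f, g⟫_ℂ = ⟪f, U (-t) g⟫_ℂ := by
  rw [← hU.inner_map_map (-t) (U t f) g, ← hU.map_add, neg_add_cancel, hU.map_zero]

theorem hasGeneratorAt_apply (hU : IsUnitaryGroup U) {f g : H} (h : HasGeneratorAt U f g) (t : ℝ) :
    HasGeneratorAt U (U t f) (U t g) := by
  refine (((U t).continuous.tendsto g).comp h).congr fun s => ?_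
  simp only [Function.comp, map_smul, map_sub]
  rw [← hU.map_add, ← hU.map_add, add_comm]

theorem hasDerivAt_apply (hU : IsUnitaryGroup U) {f g : H} (h : HasGeneratorAt U f g) (t : ℝ) :
    HasDerivAt (fun t => U t f) (U t g) t := by
  rw [hasDerivAt_iff_tendsto_slope_zero]
  refine (hU.hasGeneratorAt_apply h t).congr fun s => ?_
  rw [← hU.map_add, add_comm s t, Complex.coe_smul]

end IsUnitaryGroup

/-- A linear map on a dense subspace whose quadratic form vanishes is zero. -/
theorem eq_zero_of_inner_self_eq_zero {D : Submodule ℂ H} (hD : Dense (D : Set H))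
    (A : D →ₗ[ℂ] H) (h : ∀ f : D, ⟪(f : H), A f⟫_ℂ = 0) (f : D) : A f = 0 := by
  have key : ∀ f g : D, ⟪(g : H), A f⟫_ℂ = 0 := by
    intro f g
    -- Polarization: the vectors `f + g` and `f + i g` give the sum and the difference of the two
    -- cross terms.
    have h1 := h (f + g)
    have h2 := h (f + Complex.I • g)
    simp only [map_add, map_smul, Submodule.coe_add, Submodule.coe_smul, inner_add_left,
      inner_add_right, inner_smul_left, inner_smul_right, h, Complex.conj_I] at h1 h2
    have h3 : Complex.I * (⟪(f : H), A g⟫_ℂ - ⟪(g : H), A f⟫_ℂ) = 0 := by linear_combination h2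
    have h4 := (mul_eq_zero.1 h3).resolve_left Complex.I_ne_zero
    linear_combination (h1 - h4) / 2
  refine hD.eq_zero_of_inner_left (𝕜 := ℂ) fun v hv => ?_
  have := key f ⟨v, hv⟩
  rw [← inner_conj_symm, this, map_zero]

end UnitaryGroup

/-! ### The spectral measure of the generator determines the group -/

namespace ProjectionValuedMeasure

variable {H : Type*} [NormedAddCommGroup H] [InnerProductSpace ℂ H] [CompleteSpace H]
  {E : ProjectionValuedMeasure ℝ H} {V : H →ₗ.[ℂ] H}

theorem IsSpectralMeasureOf.mem_domain_iff_memLp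
    (hE : E.IsSpectralMeasureOf (fun ω : ℝ => Complex.I * (ω : ℂ)) V) (f : H) :
    f ∈ V.domain ↔ MemLp (fun ω : ℝ => Complex.I * (ω : ℂ)) 2 (E.scalarMeasure f) := by
  rw [hE.mem_domain_iff]
  exact ⟨memLp_two_of_lintegral_lt_top measurable_freq.aestronglyMeasurable,
    fun h => h.lintegral_norm_sq_lt_top⟩

/-- The frequency is bounded on the range of a cutoff to a bounded band. With `tendsto_proj_Icc`
this makes the domain dense. -/
theorem IsSpectralMeasureOf.proj_Icc_mem_domain
    (hE : E.IsSpectralMeasureOf (fun ω : ℝ => Complex.I * (ω : ℂ)) V) (f : H) (n : ℝ) :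
    E.proj (Icc (-n) n) f ∈ V.domain := by
  have hm : Measurable ((Icc (-n) n).indicator fun _ => (1 : ℂ)) :=
    measurable_const.indicator measurableSet_Icc
  rw [hE.mem_domain_iff_memLp, ← E.specInt_indicator f measurableSet_Icc]
  refine E.memLp_scalarMeasure_specInt hm (memLp_indicator_one measurableSet_Icc)
    measurable_freq (memLp_two_of_norm_le (C := |n|)
      (measurable_freq.mul hm).aestronglyMeasurable fun ω => ?_)
  by_cases hω : ω ∈ Icc (-n) n
  · simp only [hω, indicator_of_mem, mul_one, norm_mul, Complex.norm_I, one_mul, Complex.norm_real,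
      Real.norm_eq_abs]
    exact (abs_le.2 hω).trans (le_abs_self n)
  · simp [hω]

theorem tendsto_proj_Icc (f : H) :
    Tendsto (fun n : ℕ => E.proj (Icc (-(n : ℝ)) n) f) atTop (𝓝 f) := by
  have h := E.tendsto_specInt_of_dominated (f := f) (ψ := fun _ => 1) (G := fun _ => 1) (l := atTop)
    (φ := fun n : ℕ => (Icc (-(n : ℝ)) n).indicator fun _ => (1 : ℂ))
    (fun n => measurable_const.indicator measurableSet_Icc) measurable_const (memLp_const 1)
    (Eventually.of_forall fun n x => ?_) (fun x => by simp) fun x => ?_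
  · simpa only [E.specInt_indicator f measurableSet_Icc, E.specInt_one] using h
  · by_cases hx : x ∈ Icc (-(n : ℝ)) n <;> simp [hx]
  · refine tendsto_const_nhds.congr' ?_
    filter_upwards [eventually_ge_atTop ⌈|x|⌉₊] with n hn
    have : |x| ≤ n := (Nat.le_ceil _).trans (by exact_mod_cast hn)
    rw [indicator_of_mem (show x ∈ Icc (-(n : ℝ)) n from abs_le.1 this)]

theorem IsSpectralMeasureOf.dense_domain
    (hE : E.IsSpectralMeasureOf (fun ω : ℝ => Complex.I * (ω : ℂ)) V) :
    Dense (V.domain : Set H) := fun f =>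
  mem_closure_of_tendsto (tendsto_proj_Icc f)
    (Eventually.of_forall fun n => hE.proj_Icc_mem_domain f n)

/-- The operator is the spectral integral of the frequency, not only in the sense of forms. -/
theorem IsSpectralMeasureOf.apply_eq_specInt
    (hE : E.IsSpectralMeasureOf (fun ω : ℝ => Complex.I * (ω : ℂ)) V) (f : V.domain) :
    V f = E.specInt f (fun ω : ℝ => Complex.I * (ω : ℂ)) := by
  have hmem := fun f : V.domain => (hE.mem_domain_iff_memLp (f : H)).1 f.2
  -- The hypothesis only fixes the quadratic form of `V`; the difference with the spectral integral
  -- has zero form on a dense domain.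
  let A : V.domain →ₗ[ℂ] H :=
    { toFun := fun f => V f - E.specInt f (fun ω : ℝ => Complex.I * (ω : ℂ))
      map_add' := fun f g => by
        rw [LinearPMap.map_add, Submodule.coe_add,
          E.specInt_vec_add measurable_freq (hmem f) (hmem g)]
        abel
      map_smul' := fun c f => by
        rw [LinearPMap.map_smul, Submodule.coe_smul, E.specInt_vec_smul c measurable_freq (hmem f),
          RingHom.id_apply, smul_sub] }
  refine sub_eq_zero.1 (eq_zero_of_inner_self_eq_zero hE.dense_domain A (fun f => ?_) f)
  change ⟪(f : H), V f - E.specInt f _⟫_ℂ = 0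
  rw [inner_sub_right, hE.inner_apply, E.inner_self_specInt (hmem f), sub_self]

/-- The form is `i` times a real integral. This skewness is what gives uniqueness for `u' = V u`. -/
theorem IsSpectralMeasureOf.re_inner_apply
    (hE : E.IsSpectralMeasureOf (fun ω : ℝ => Complex.I * (ω : ℂ)) V) (f : V.domain) :
    (⟪(f : H), V f⟫_ℂ).re = 0 := by
  rw [hE.inner_apply, integral_const_mul, integral_complex_ofReal]
  simp

variable (E) in
theorem memLp_freq_mul_freqExp {f : H} (t : ℝ)
    (h : MemLp (fun ω : ℝ => Complex.I * (ω : ℂ)) 2 (E.scalarMeasure f)) :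
    MemLp (fun ω : ℝ => Complex.I * (ω : ℂ) * freqExp t ω) 2 (E.scalarMeasure f) :=
  h.mono (measurable_freq.mul (measurable_freqExp t)).aestronglyMeasurable
    (Eventually.of_forall fun ω => by rw [norm_mul _ (freqExp t ω), norm_freqExp, mul_one])

variable (E) in
theorem hasDerivAt_specInt_freqExp {f : H} (t : ℝ)
    (h : MemLp (fun ω : ℝ => Complex.I * (ω : ℂ)) 2 (E.scalarMeasure f)) :
    HasDerivAt (fun t => E.specInt f (freqExp t))
      (E.specInt f fun ω => Complex.I * ω * freqExp t ω) t := by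
  rw [hasDerivAt_iff_tendsto_slope_zero]
  refine (((E.isometry f).continuous.tendsto _).comp
    (tendsto_l2Class_freqExp_slope h t)).congr fun s => ?_
  have := E.specInt_const_mul (f := f) ((s⁻¹ : ℝ) : ℂ)
    ((memLp_freqExp _ (t + s)).sub (memLp_freqExp _ t))
  rw [← E.specInt_sub (memLp_freqExp _ (t + s)) (memLp_freqExp _ t), ← Complex.coe_smul]
  exact this

/-- Both sides solve `u' = V u` with initial value `f`. The squared norm of their difference has
derivative `2 Re ⟪u, V u⟫ = 0`, so it keeps its initial value `0`. -/
theorem IsSpectralMeasureOf.apply_eq_specInt_freqExp_of_mem {U : ℝ → H →L[ℂ] H}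
    (hU : IsUnitaryGroup U)
    (hE : E.IsSpectralMeasureOf (fun ω : ℝ => Complex.I * (ω : ℂ)) (generator U)) (t : ℝ) {f : H}
    (hf : f ∈ (generator U).domain) : U t f = E.specInt f (freqExp t) := by
  have hf2 := (hE.mem_domain_iff_memLp f).1 hf
  have hw : ∀ t, E.specInt f (freqExp t) ∈ (generator U).domain := fun t =>
    (hE.mem_domain_iff_memLp _).2 (E.memLp_scalarMeasure_specInt (measurable_freqExp t)
      (memLp_freqExp _ t) measurable_freq (E.memLp_freq_mul_freqExp t hf2))
  have hw' : ∀ t, HasDerivAt (fun t => E.specInt f (freqExp t)) (generator U ⟨_, hw t⟩) t := by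
    intro t
    rw [hE.apply_eq_specInt, E.specInt_specInt (measurable_freqExp t)
      (memLp_freqExp _ t) measurable_freq (E.memLp_freq_mul_freqExp t hf2)]
    exact E.hasDerivAt_specInt_freqExp t hf2
  have hgen := fun t => hU.hasGeneratorAt_apply (hasGeneratorAt_generator ⟨f, hf⟩) t
  have hu : ∀ t, U t f ∈ (generator U).domain := fun t => ⟨_, hgen t⟩
  have hu' : ∀ t, HasDerivAt (fun t => U t f) (generator U ⟨_, hu t⟩) t := by
    intro t
    rw [generator_apply (hgen t)]
    exact hU.hasDerivAt_apply (hasGeneratorAt_generator ⟨f, hf⟩) t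
  have hd : ∀ t, HasDerivAt (fun t => ⟪U t f - E.specInt f (freqExp t),
      U t f - E.specInt f (freqExp t)⟫_ℂ) 0 t := by
    intro t
    have h1 := (hu' t).sub (hw' t)
    have h3 := hE.re_inner_apply (⟨_, hu t⟩ - ⟨_, hw t⟩)
    rw [LinearPMap.map_sub] at h3
    simp only [AddSubgroupClass.coe_sub] at h3
    have h4 : ⟪U t f - E.specInt f (freqExp t),
        generator U ⟨_, hu t⟩ - generator U ⟨_, hw t⟩⟫_ℂ +
        ⟪generator U ⟨_, hu t⟩ - generator U ⟨_, hw t⟩,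
          U t f - E.specInt f (freqExp t)⟫_ℂ = 0 := by
      rw [← inner_conj_symm (generator U ⟨_, hu t⟩ - generator U ⟨_, hw t⟩), Complex.add_conj, h3]
      simp
    have h2 := HasDerivAt.inner ℂ h1 h1
    simp only [Pi.sub_apply] at h2
    rwa [h4] at h2
  have hconst := is_const_of_deriv_eq_zero (fun t => (hd t).differentiableAt)
    (fun t => (hd t).deriv) t 0
  have h0 : E.specInt f (freqExp 0) = f := by
    rw [funext freqExp_zero, E.specInt_one]
  simp only [h0, hU.map_zero, sub_self, inner_zero_left] at hconst
  exact sub_eq_zero.1 (inner_self_eq_zero.1 hconst)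

/-- The group is the spectral integral of the characters, for every spectral measure of its
generator. -/
theorem IsSpectralMeasureOf.apply_eq_specInt_freqExp {U : ℝ → H →L[ℂ] H}
    (hU : IsUnitaryGroup U)
    (hE : E.IsSpectralMeasureOf (fun ω : ℝ => Complex.I * (ω : ℂ)) (generator U)) (t : ℝ) (f : H) :
    U t f = E.specInt f (freqExp t) := by
  have h1 : Tendsto (fun n : ℕ => U t (E.proj (Icc (-(n : ℝ)) n) f)) atTop (𝓝 (U t f)) :=
    ((U t).continuous.tendsto _).comp (tendsto_proj_Icc f)
  refine tendsto_nhds_unique h1 ?_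
  rw [tendsto_iff_norm_sub_tendsto_zero]
  refine (tendsto_iff_norm_sub_tendsto_zero.1 (tendsto_proj_Icc (E := E) f)).congr fun n => ?_
  -- Since `|e^{iωt}| = 1`, the error of the right-hand side has exactly the norm of `E([-n,n]) f -
  -- f`.
  rw [hE.apply_eq_specInt_freqExp_of_mem hU t (hE.proj_Icc_mem_domain f n),
    ← E.specInt_vec_sub (measurable_freqExp t) (memLp_freqExp _ t) (memLp_freqExp _ t),
    ← sq_eq_sq₀ (norm_nonneg _) (norm_nonneg _), E.norm_sq_specInt (memLp_freqExp _ t)]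
  simp only [norm_freqExp, one_pow, integral_const, smul_eq_mul, mul_one]
  rw [E.scalarMeasure_real _ MeasurableSet.univ, E.proj_univ]
  rfl

end ProjectionValuedMeasure

/-! ### Bochner's theorem for unitary groups -/

section Fourier

open FourierTransform

theorem continuous_fourier_of_integrable {ψ : ℝ → ℂ} (hψ : Integrable ψ) : Continuous (𝓕 ψ) :=
  VectorFourier.fourierIntegral_continuous Real.continuous_fourierChar
    continuous_inner hψ

theorem integral_fourier_mul_eq_flip {ψ g : ℝ → ℂ} (hψ : Integrable ψ) (hg : Integrable g) :
    ∫ x, 𝓕 ψ x * g x = ∫ x, ψ x * 𝓕 g x := by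
  have := VectorFourier.integral_fourierIntegral_smul_eq_flip (L := innerₗ ℝ)
    Real.continuous_fourierChar continuous_inner hψ hg
  rw [flip_innerₗ] at this
  exact this

/-- The `L¹` norm does not depend on `b`, which keeps the bound in `integrable_of_fourier_nonneg`
uniform as `b → 0`. -/
theorem integral_norm_fourier_gaussian {b : ℝ} (hb : 0 < b) :
    Integrable (𝓕 fun x : ℝ => Complex.exp (-Real.pi * b * x ^ 2)) ∧
    ∫ t, ‖𝓕 (fun x : ℝ => Complex.exp (-Real.pi * b * x ^ 2)) t‖ = 1 := by
  rw [fourier_gaussian_pi (by simpa using hb)]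
  have hpb : 0 < Real.pi / b := by positivity
  have hnorm : ∀ t : ℝ, ‖1 / (b : ℂ) ^ (1 / 2 : ℂ) * Complex.exp (-Real.pi / b * t ^ 2)‖ =
      (√b)⁻¹ * Real.exp (-(Real.pi / b) * t ^ 2) := by
    intro t
    rw [norm_mul, norm_div, norm_one, Complex.norm_cpow_eq_rpow_re_of_pos hb, Complex.norm_exp]
    have h1 : (-Real.pi / b * t ^ 2 : ℂ) = ((-(Real.pi / b) * t ^ 2 : ℝ) : ℂ) := by
      push_cast; ring
    rw [h1, Complex.ofReal_re, Real.sqrt_eq_rpow]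
    norm_num
  constructor
  · rw [← integrable_norm_iff (by fun_prop)]
    simp_rw [hnorm]
    exact (integrable_exp_neg_mul_sq hpb).const_mul _
  · simp_rw [hnorm]
    rw [integral_const_mul, integral_gaussian, div_div_cancel₀ Real.pi_ne_zero]
    exact inv_mul_cancel₀ (by positivity)

/-- A nonnegative Fourier transform of a bounded integrable function is integrable. -/
theorem integrable_of_fourier_nonneg {ψ : ℝ → ℂ} (hψ : Integrable ψ) {C : ℝ}
    (hC : ∀ x, ‖ψ x‖ ≤ C) {F : ℝ → ℝ} (hF : ∀ x, 𝓕 ψ x = F x) (h0 : ∀ x, 0 ≤ F x) :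
    Integrable F := by
  have hFc : Continuous F := by
    have h1 : F = fun x => (𝓕 ψ x).re := by ext x; rw [hF, Complex.ofReal_re]
    rw [h1]
    exact Complex.continuous_re.comp (continuous_fourier_of_integrable hψ)
  have hC0 : 0 ≤ C := (norm_nonneg _).trans (hC 0)
  have hg : ∀ b : ℝ, 0 < b → Integrable fun x : ℝ => Complex.exp (-Real.pi * b * x ^ 2) := by
    intro b hb
    have := (integrable_exp_neg_mul_sq (b := Real.pi * b) (by positivity)).ofReal (𝕜 := ℂ)
    refine this.congr (Eventually.of_forall fun x => ?_)
    simp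
  have hFbd : ∀ x, ‖F x‖ ≤ ∫ y, ‖ψ y‖ := by
    intro x
    have := VectorFourier.norm_fourierIntegral_le_integral_norm Real.fourierChar volume
      (innerₗ ℝ) ψ x
    have h2 : ‖F x‖ = ‖𝓕 ψ x‖ := by rw [hF, Complex.norm_real]
    rw [h2]
    exact this
  have hexp : ∀ b : ℝ, 0 < b → Integrable fun x : ℝ => F x * Real.exp (-(Real.pi * b) * x ^ 2) :=
    fun b hb => (integrable_exp_neg_mul_sq (b := Real.pi * b) (by positivity)).bdd_mul
      hFc.aestronglyMeasurable (Eventually.of_forall hFbd)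
  -- Moving the transform from `ψ` to the Gaussian leaves `ψ` against a kernel of `L¹` norm one.
  have hle : ∀ b : ℝ, 0 < b → ∫ x, F x * Real.exp (-(Real.pi * b) * x ^ 2) ≤ C := by
    intro b hb
    have h1 : ((∫ x, F x * Real.exp (-(Real.pi * b) * x ^ 2) : ℝ) : ℂ) =
        ∫ x, ψ x * 𝓕 (fun x : ℝ => Complex.exp (-Real.pi * b * x ^ 2)) x := by
      rw [← integral_fourier_mul_eq_flip hψ (hg b hb), ← integral_complex_ofReal]
      congr 1
      ext x
      rw [hF]
      simp
    have h2 : |∫ x, F x * Real.exp (-(Real.pi * b) * x ^ 2)| ≤ C := by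
      rw [← Real.norm_eq_abs, ← Complex.norm_real, h1]
      obtain ⟨hi, hn⟩ := integral_norm_fourier_gaussian hb
      calc _ ≤ ∫ x, ‖ψ x * 𝓕 (fun x : ℝ => Complex.exp (-Real.pi * b * x ^ 2)) x‖ :=
            norm_integral_le_integral_norm _
        _ ≤ ∫ x, C * ‖𝓕 (fun x : ℝ => Complex.exp (-Real.pi * b * x ^ 2)) x‖ := by
            refine integral_mono_of_nonneg (Eventually.of_forall fun x => norm_nonneg _)
              (hi.norm.const_mul C) (Eventually.of_forall fun x => ?_)
            simp only [norm_mul]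
            gcongr
            exact hC x
        _ = C := by rw [integral_const_mul, hn, mul_one]
    exact (le_abs_self _).trans h2
  refine ⟨hFc.aestronglyMeasurable, ?_⟩
  rw [hasFiniteIntegral_iff_norm]
  have hb : ∀ n : ℕ, (0 : ℝ) < 1 / ((n : ℝ) + 1) := fun n => by positivity
  have hlim : ∀ x : ℝ, Tendsto (fun n : ℕ => ENNReal.ofReal
      (F x * Real.exp (-(Real.pi * (1 / ((n : ℝ) + 1))) * x ^ 2))) atTop
      (𝓝 (ENNReal.ofReal ‖F x‖)) := by
    intro x
    refine ENNReal.tendsto_ofReal ?_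
    rw [Real.norm_of_nonneg (h0 x)]
    have h1 : Tendsto (fun n : ℕ => -(Real.pi * (1 / ((n : ℝ) + 1))) * x ^ 2) atTop
        (𝓝 (-(Real.pi * 0) * x ^ 2)) :=
      ((tendsto_one_div_add_atTop_nhds_zero_nat.const_mul Real.pi).neg).mul_const _
    simpa using ((Real.continuous_exp.tendsto _).comp h1).const_mul (F x)
  -- Fatou's lemma as the Gaussian weights tend to `1`; nonnegativity of `F` makes the uniform bound
  -- one on `∫ |F|`.
  calc ∫⁻ x, ENNReal.ofReal ‖F x‖
      = ∫⁻ x, liminf (fun n : ℕ => ENNReal.ofReal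
          (F x * Real.exp (-(Real.pi * (1 / ((n : ℝ) + 1))) * x ^ 2))) atTop :=
        lintegral_congr fun x => ((hlim x).liminf_eq).symm
    _ ≤ liminf (fun n : ℕ => ∫⁻ x, ENNReal.ofReal
          (F x * Real.exp (-(Real.pi * (1 / ((n : ℝ) + 1))) * x ^ 2))) atTop :=
        lintegral_liminf_le fun n => by fun_prop
    _ ≤ liminf (fun n : ℕ => ENNReal.ofReal C) atTop := by
        refine liminf_le_liminf (Eventually.of_forall fun n => ?_)
        rw [← ofReal_integral_eq_lintegral_ofReal (hexp _ (hb n))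
          (Eventually.of_forall fun x => mul_nonneg (h0 x) (Real.exp_pos _).le)]
        exact ENNReal.ofReal_le_ofReal (hle _ (hb n))
    _ < ∞ := by rw [liminf_const]; exact ENNReal.ofReal_lt_top

/-- A continuous integrable function with nonnegative Fourier transform is the characteristic
function of a finite measure. -/
theorem exists_charFun_eq_of_fourier_nonneg {ψ : ℝ → ℂ} (hc : Continuous ψ) (hψ : Integrable ψ)
    {C : ℝ} (hC : ∀ x, ‖ψ x‖ ≤ C) {F : ℝ → ℝ} (hF : ∀ x, 𝓕 ψ x = F x) (h0 : ∀ x, 0 ≤ F x) :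
    ∃ ν : Measure ℝ, IsFiniteMeasure ν ∧ ∀ t, charFun ν t = ψ t := by
  have hFi := integrable_of_fourier_nonneg hψ hC hF h0
  have hFm : AEMeasurable (fun x => ENNReal.ofReal (F x)) := hFi.aemeasurable.ennreal_ofReal
  have hfin : IsFiniteMeasure (volume.withDensity fun x => ENNReal.ofReal (F x)) :=
    isFiniteMeasure_withDensity_ofReal hFi.2
  -- The dilation reconciles `e^{2πitx}` in the inverse Fourier transform with `e^{itx}` in
  -- `charFun`.
  refine ⟨(volume.withDensity fun x => ENNReal.ofReal (F x)).map ((2 * Real.pi) • ·),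
    Measure.isFiniteMeasure_map _ _, fun t => ?_⟩
  have hFi2 : Integrable (𝓕 ψ) := by
    rw [show 𝓕 ψ = fun x => (F x : ℂ) from funext hF]
    exact hFi.ofReal
  rw [charFun_map_smul, charFun_apply_real, ← hψ.fourierInv_fourier_eq hFi2 hc.continuousAt,
    integral_withDensity_eq_integral_toReal_smul₀ hFm
      (Eventually.of_forall fun _ => ENNReal.ofReal_lt_top), Real.fourierInv_eq']
  congr 1
  ext x
  rw [ENNReal.toReal_ofReal (h0 x), hF, Complex.real_smul, smul_eq_mul, mul_comm]
  congr 2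
  simp only [RCLike.inner_apply, conj_trivial]
  push_cast
  ring

end Fourier

/-! ### Lévy's continuity theorem -/

section LevyLimit

/-- A pointwise limit of characteristic functions of probability measures that is continuous at
`0` is a characteristic function. -/
theorem exists_charFun_eq_of_tendsto {ν : ℕ → Measure ℝ} [hν : ∀ n, IsProbabilityMeasure (ν n)]
    {φ : ℝ → ℂ} (hφ : ContinuousAt φ 0)
    (h : ∀ t, Tendsto (fun n => charFun (ν n) t) atTop (𝓝 (φ t))) :
    ∃ ν₀ : Measure ℝ, IsFiniteMeasure ν₀ ∧ ∀ t, charFun ν₀ t = φ t := by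
  let P : ℕ → ProbabilityMeasure ℝ := fun n => ⟨ν n, hν n⟩
  have htight := isTightMeasureSet_of_tendsto_charFun hφ h
  have hK : IsCompact (closure (range P)) := by
    refine isCompact_closure_of_isTightMeasureSet (htight.subset ?_)
    rintro _ ⟨_, ⟨n, rfl⟩, rfl⟩
    exact ⟨n, rfl⟩
  -- Convergence along an ultrafilter replaces extracting a subsequence; the limit of the
  -- characteristic functions is already known.
  let L : Ultrafilter ℕ := Ultrafilter.of atTop
  obtain ⟨P₀, -, hP₀⟩ := hK.ultrafilter_le_nhds (L.map P) (by
    rw [le_principal_iff]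
    exact Filter.mem_of_superset (range_mem_map) subset_closure)
  have hP : Tendsto P L (𝓝 P₀) := hP₀
  refine ⟨P₀, inferInstance, fun t => ?_⟩
  rw [ProbabilityMeasure.tendsto_iff_forall_integral_rclike_tendsto ℂ] at hP
  have h1 := hP (BoundedContinuousFunction.innerProbChar t)
  simp_rw [← charFun_eq_integral_innerProbChar] at h1
  exact tendsto_nhds_unique h1 ((h t).mono_left (Ultrafilter.of_le atTop))

end LevyLimit

/-! ### Matrix coefficients as characteristic functions -/

namespace IsUnitaryGroup

open FourierTransform

variable {H : Type*} [NormedAddCommGroup H] [InnerProductSpace ℂ H]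
  {U : ℝ → H →L[ℂ] H}

theorem norm_inner_apply_le (hU : IsUnitaryGroup U) (f : H) (t : ℝ) :
    ‖⟪f, U t f⟫_ℂ‖ ≤ ‖f‖ ^ 2 := by
  rw [sq]
  calc _ ≤ ‖f‖ * ‖U t f‖ := norm_inner_le_norm _ _
    _ = _ := by rw [hU.norm_map]

theorem continuous_inner_apply (hU : IsUnitaryGroup U) (f : H) :
    Continuous fun t => ⟪f, U t f⟫_ℂ := continuous_const.inner (hU.continuous_apply f)

theorem integrable_gaussian_smul (hU : IsUnitaryGroup U) (f : H) {b : ℝ} (hb : 0 < b) (x : ℝ) :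
    Integrable fun s : ℝ => Complex.exp (-b * s ^ 2 - 2 * Real.pi * x * s * Complex.I) • U s f := by
  have hg := (integrable_exp_neg_mul_sq hb).mul_const ‖f‖
  refine hg.mono' ((by fun_prop : Continuous _).smul
    (hU.continuous_apply f)).aestronglyMeasurable (Eventually.of_forall fun s => ?_)
  rw [norm_smul, hU.norm_map, Complex.norm_exp]
  gcongr
  simp [← Complex.ofReal_pow]

/-- The Fourier transform of a Gaussian times a matrix coefficient is a squared norm. -/
theorem fourier_gaussian_mul_inner [CompleteSpace H] (hU : IsUnitaryGroup U) (f : H) {b : ℝ} (hb : 0 < b) (x : ℝ) :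
    ((‖∫ s : ℝ, Complex.exp (-b * s ^ 2 - 2 * Real.pi * x * s * Complex.I) • U s f‖ ^ 2 : ℝ) : ℂ)
      = (√(Real.pi / (2 * b)) : ℝ) *
        𝓕 (fun u : ℝ => Complex.exp (-(b / 2) * u ^ 2) * ⟪f, U u f⟫_ℂ) x := by
  have hi := hU.integrable_gaussian_smul f hb x
  set g : ℝ → ℂ := fun s => Complex.exp (-b * s ^ 2 - 2 * Real.pi * x * s * Complex.I) with hg
  set v := ∫ s : ℝ, g s • U s f with hv
  have hnorm : ∀ s, ‖g s‖ = Real.exp (-b * s ^ 2) := by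
    intro s
    rw [hg, Complex.norm_exp]
    simp [← Complex.ofReal_pow]
  have hgc : Continuous g := by fun_prop
  -- The shift `u ↦ u + s` uses `⟪U s f, U (u + s) f⟫ = ⟪f, U u f⟫`, leaving a coefficient that
  -- depends on `u` alone.
  have h1 : ((‖v‖ ^ 2 : ℝ) : ℂ) = ∫ s, ∫ u, (starRingEnd ℂ) (g s) * g (u + s) * ⟪f, U u f⟫_ℂ := by
    have h2 : ((‖v‖ ^ 2 : ℝ) : ℂ) = ⟪v, v⟫_ℂ := by
      rw [inner_self_eq_norm_sq_to_K]; simp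
    have h3 : ∀ w : H, ⟪w, v⟫_ℂ = ∫ u, g u * ⟪w, U u f⟫_ℂ := by
      intro w
      rw [hv, ← integral_inner hi]
      simp_rw [inner_smul_right]
      rfl
    have h4 : ⟪v, v⟫_ℂ = ∫ s, (starRingEnd ℂ) (g s) * ⟪U s f, v⟫_ℂ := by
      rw [← inner_conj_symm, h3, ← integral_conj]
      congr 1
      ext s
      rw [map_mul, inner_conj_symm]
    rw [h2, h4]
    congr 1
    ext s
    rw [h3, ← integral_add_right_eq_self _ s, ← integral_const_mul]
    congr 1
    ext u
    rw [add_comm u s, hU.map_add, hU.inner_map_map]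
    ring
  rw [h1, integral_integral_swap]
  · rw [Real.fourier_real_eq_integral_exp_smul, ← integral_const_mul]
    congr 1
    ext u
    rw [integral_mul_const]
    -- Completing the square: `s² + (u + s)² = 2 (s + u/2)² + u²/2`. The phases in `s` cancel, so
    -- the `s`-integral is a Gaussian constant.
    have h5 : ∀ s : ℝ, (starRingEnd ℂ) (g s) * g (u + s) =
        Complex.exp (-(b / 2) * u ^ 2 - 2 * Real.pi * x * u * Complex.I) *
          ((Real.exp (-(2 * b) * (s + u / 2) ^ 2) : ℝ) : ℂ) := by
      intro s
      rw [Complex.ofReal_exp, hg, ← Complex.exp_conj, ← Complex.exp_add, ← Complex.exp_add]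
      congr 1
      simp only [map_sub, map_mul, map_neg, map_pow, Complex.conj_ofReal, Complex.conj_I]
      rw [show (starRingEnd ℂ) 2 = 2 from Complex.conj_ofNat 2]
      push_cast
      ring
    simp_rw [h5]
    rw [integral_const_mul, integral_complex_ofReal,
      integral_add_right_eq_self (fun s : ℝ => Real.exp (-(2 * b) * s ^ 2)), integral_gaussian,
      smul_eq_mul, sub_eq_add_neg, Complex.exp_add]
    have h6 : (-(2 * Real.pi * x * u * Complex.I) : ℂ) =
        ((-2 * Real.pi * u * x : ℝ) : ℂ) * Complex.I := by push_cast; ring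
    rw [h6]
    ring
  -- The constant `1/3` comes from `s² + (u + s)² ≥ (s² + u²)/3`.
  · have hbd : Integrable (fun p : ℝ × ℝ => Real.exp (-(b / 3) * p.1 ^ 2) *
        (Real.exp (-(b / 3) * p.2 ^ 2) * ‖f‖ ^ 2)) (volume.prod volume) :=
      (integrable_exp_neg_mul_sq (by positivity)).mul_prod
        ((integrable_exp_neg_mul_sq (by positivity)).mul_const _)
    refine hbd.mono' ?_ (Eventually.of_forall fun p => ?_)
    · have := (hU.continuous_inner_apply f).comp continuous_snd (X := ℝ × ℝ)
      refine Continuous.aestronglyMeasurable (Continuous.mul ?_ this)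
      exact (Complex.continuous_conj.comp (hgc.comp continuous_fst)).mul
        (hgc.comp (continuous_snd.add continuous_fst))
    · simp only [Function.uncurry, norm_mul, RCLike.norm_conj, hnorm]
      rw [← mul_assoc, ← Real.exp_add, ← Real.exp_add]
      refine mul_le_mul (Real.exp_le_exp.2 ?_) (hU.norm_inner_apply_le f p.2) (norm_nonneg _)
        (Real.exp_pos _).le
      have : 0 ≤ b * (p.1 ^ 2 + (p.2 + p.1) ^ 2 - (p.1 ^ 2 + p.2 ^ 2) / 3) :=
        mul_nonneg hb.le (by nlinarith [sq_nonneg (5 * p.1 + 3 * p.2), sq_nonneg p.2])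
      linarith

/-- The Gaussian makes the coefficient integrable, and by `fourier_gaussian_mul_inner` its Fourier
transform is a positive multiple of a squared norm. -/
theorem exists_measure_charFun_eq_gaussian_mul [CompleteSpace H] (hU : IsUnitaryGroup U) (f : H)
    {b : ℝ} (hb : 0 < b) : ∃ ν : Measure ℝ, IsFiniteMeasure ν ∧
      ∀ t : ℝ, charFun ν t = Complex.exp (-(b / 2) * t ^ 2) * ⟪f, U t f⟫_ℂ := by
  have hexp : ∀ t : ℝ, ‖Complex.exp (-((b : ℂ) / 2) * (t : ℂ) ^ 2)‖ =
      Real.exp (-(b / 2) * t ^ 2) := by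
    intro t
    rw [Complex.norm_exp]
    simp [← Complex.ofReal_pow]
  have hc : Continuous fun t : ℝ => Complex.exp (-((b : ℂ) / 2) * (t : ℂ) ^ 2) * ⟪f, U t f⟫_ℂ :=
    (by fun_prop : Continuous fun t : ℝ => Complex.exp (-((b : ℂ) / 2) * (t : ℂ) ^ 2)).mul
      (hU.continuous_inner_apply f)
  have hle : ∀ t : ℝ, ‖Complex.exp (-((b : ℂ) / 2) * (t : ℂ) ^ 2) * ⟪f, U t f⟫_ℂ‖ ≤
      Real.exp (-(b / 2) * t ^ 2) * ‖f‖ ^ 2 := by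
    intro t
    rw [norm_mul, hexp]
    gcongr
    exact hU.norm_inner_apply_le f t
  have hs : 0 < √(Real.pi / (2 * b)) := Real.sqrt_pos.2 (by positivity)
  refine exists_charFun_eq_of_fourier_nonneg (C := ‖f‖ ^ 2) hc
    (((integrable_exp_neg_mul_sq (by positivity)).mul_const _).mono' hc.aestronglyMeasurable
      (Eventually.of_forall hle)) (fun t => (hle t).trans ?_)
    (F := fun x => (√(Real.pi / (2 * b)))⁻¹ *
      ‖∫ s : ℝ, Complex.exp (-b * s ^ 2 - 2 * Real.pi * x * s * Complex.I) • U s f‖ ^ 2)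
    (fun x => ?_) fun x => by positivity
  · refine mul_le_of_le_one_left (by positivity) (Real.exp_le_one_iff.2 ?_)
    nlinarith [sq_nonneg t]
  · rw [Complex.ofReal_mul, hU.fourier_gaussian_mul_inner f hb x, ← mul_assoc, ← Complex.ofReal_mul,
      inv_mul_cancel₀ hs.ne', Complex.ofReal_one, one_mul]

/-- Let the damping parameter tend to `0`. Normalizing `f` makes the damped measures probability
measures, as the Lévy limit requires. -/
theorem exists_measure_charFun_eq_of_norm_eq_one [CompleteSpace H] (hU : IsUnitaryGroup U) {f : H}
    (hf : ‖f‖ = 1) :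
    ∃ ν : Measure ℝ, IsFiniteMeasure ν ∧ ∀ t, charFun ν t = ⟪f, U t f⟫_ℂ := by
  choose ν hfin hν using fun n : ℕ =>
    hU.exists_measure_charFun_eq_gaussian_mul f (b := 1 / ((n : ℝ) + 1)) (by positivity)
  have hprob : ∀ n, IsProbabilityMeasure (ν n) := by
    intro n
    have h0 := hν n 0
    rw [charFun_zero, hU.map_zero, inner_self_eq_norm_sq_to_K, hf] at h0
    have h1 : (ν n).real univ = 1 := by
      apply Complex.ofReal_injective
      simpa using h0
    exact ⟨by rwa [Measure.real, ENNReal.toReal_eq_one_iff] at h1⟩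
  refine exists_charFun_eq_of_tendsto (hU.continuous_inner_apply f).continuousAt (ν := ν) fun t => ?_
  simp_rw [hν]
  have h1 : Tendsto (fun n : ℕ => (((1 / ((n : ℝ) + 1) : ℝ)) : ℂ)) atTop (𝓝 ((0 : ℝ) : ℂ)) :=
    (Complex.continuous_ofReal.tendsto 0).comp tendsto_one_div_add_atTop_nhds_zero_nat
  have h2 : Continuous fun z : ℂ => Complex.exp (-(z / 2) * (t : ℂ) ^ 2) * ⟪f, U t f⟫_ℂ := by
    fun_prop
  simpa [Function.comp_def] using (h2.tendsto _).comp h1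

/-- Bochner's theorem for the matrix coefficients of a unitary group. -/
theorem exists_measure_charFun_eq [CompleteSpace H] (hU : IsUnitaryGroup U) (f : H) :
    ∃ ν : Measure ℝ, IsFiniteMeasure ν ∧ ∀ t, charFun ν t = ⟪f, U t f⟫_ℂ := by
  rcases eq_or_ne f 0 with rfl | hf
  · exact ⟨0, inferInstance, fun t => by simp⟩
  · have hf' : ‖f‖ ≠ 0 := norm_ne_zero_iff.2 hf
    obtain ⟨ν, hfin, hν⟩ := hU.exists_measure_charFun_eq_of_norm_eq_one
      (f := ((‖f‖⁻¹ : ℝ) : ℂ) • f) (by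
        rw [norm_smul, Complex.norm_real, norm_inv, norm_norm, inv_mul_cancel₀ hf'])
    refine ⟨ENNReal.ofReal (‖f‖ ^ 2) • ν, ν.smul_finite ENNReal.ofReal_ne_top, fun t => ?_⟩
    have h1 := hν t
    rw [charFun_apply_real] at h1 ⊢
    rw [integral_smul_measure, h1, map_smul, inner_smul_left, inner_smul_right, Complex.conj_ofReal,
      ENNReal.toReal_ofReal (by positivity), Complex.real_smul, ← mul_assoc, ← mul_assoc,
      ← Complex.ofReal_mul, ← Complex.ofReal_mul]
    have : ‖f‖ ^ 2 * ‖f‖⁻¹ * ‖f‖⁻¹ = 1 := by field_simp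
    rw [this, Complex.ofReal_one, one_mul]

end IsUnitaryGroup

/-! ### Trigonometric polynomials in `L²` -/

theorem integrable_freqExp_mul {ν : Measure ℝ} {k : ℝ → ℂ} (hk : Integrable k ν) (t : ℝ) :
    Integrable (fun ω => freqExp t ω * k ω) ν :=
  hk.bdd_mul (measurable_freqExp t).aestronglyMeasurable
    (Eventually.of_forall fun ω => (norm_freqExp t ω).le)

/-- A real integrable function with vanishing Fourier transform vanishes almost everywhere. -/
theorem ae_eq_zero_of_integral_freqExp_mul_ofReal {ν : Measure ℝ} [IsFiniteMeasure ν] {r : ℝ → ℝ}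
    (hr : Integrable r ν) (h : ∀ t, ∫ ω, freqExp t ω * (r ω : ℂ) ∂ν = 0) : r =ᵐ[ν] 0 := by
  -- `ENNReal.ofReal` truncates at zero, so `q = r` and `q = -r` give the positive and negative
  -- parts. Their measures have equal characteristic functions, hence coincide.
  have hchar : ∀ {q : ℝ → ℝ} (_ : Integrable q ν) (t : ℝ),
      charFun (ν.withDensity fun ω => ENNReal.ofReal (q ω)) t =
        ∫ ω, freqExp t ω * (max (q ω) 0 : ℝ) ∂ν := by
    intro q hq t
    rw [charFun_apply_real, integral_withDensity_eq_integral_toReal_smul₀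
      hq.aemeasurable.ennreal_ofReal (Eventually.of_forall fun _ => ENNReal.ofReal_lt_top)]
    congr 1
    ext ω
    rw [ENNReal.toReal_ofReal', Complex.real_smul, mul_comm, freqExp]
  have hr' : Integrable (fun ω => -r ω) ν := hr.neg
  have hfin1 : IsFiniteMeasure (ν.withDensity fun ω => ENNReal.ofReal (r ω)) :=
    isFiniteMeasure_withDensity_ofReal hr.2
  have hfin2 : IsFiniteMeasure (ν.withDensity fun ω => ENNReal.ofReal (-r ω)) :=
    isFiniteMeasure_withDensity_ofReal hr'.2
  have heq : (ν.withDensity fun ω => ENNReal.ofReal (r ω)) =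
      ν.withDensity fun ω => ENNReal.ofReal (-r ω) := by
    refine Measure.ext_of_charFun (funext fun t => ?_)
    have h1 : Integrable (fun ω => freqExp t ω * (max (r ω) 0 : ℝ)) ν :=
      integrable_freqExp_mul hr.pos_part.ofReal t
    have h2 : Integrable (fun ω => freqExp t ω * (max (-r ω) 0 : ℝ)) ν :=
      integrable_freqExp_mul hr'.pos_part.ofReal t
    rw [hchar hr, hchar hr', ← sub_eq_zero, ← integral_sub h1 h2, ← h t]
    congr 1
    ext ω
    rw [← mul_sub, ← Complex.ofReal_sub]
    congr 2
    rcases le_total 0 (r ω) with h0 | h0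
    · simp [h0]
    · simp [h0]
  rw [withDensity_eq_iff_of_sigmaFinite hr.aemeasurable.ennreal_ofReal
    hr'.aemeasurable.ennreal_ofReal] at heq
  filter_upwards [heq] with ω hω
  have h2 := congrArg ENNReal.toReal hω
  rw [ENNReal.toReal_ofReal', ENNReal.toReal_ofReal'] at h2
  rcases le_total 0 (r ω) with h0 | h0
  · simpa [h0] using h2
  · simpa [h0] using h2.symm

theorem ae_eq_zero_of_integral_freqExp_mul {ν : Measure ℝ} [IsFiniteMeasure ν] {k : ℝ → ℂ}
    (hk : Integrable k ν) (h : ∀ t, ∫ ω, freqExp t ω * k ω ∂ν = 0) : k =ᵐ[ν] 0 := by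
  have hconj : ∀ t, ∫ ω, freqExp t ω * (starRingEnd ℂ) (k ω) ∂ν = 0 := by
    intro t
    have := congrArg (starRingEnd ℂ) (h (-t))
    rw [← integral_conj, map_zero] at this
    simpa [conj_freqExp] using this
  have hkc : Integrable (fun ω => (starRingEnd ℂ) (k ω)) ν :=
    (Complex.conjCLE : ℂ →L[ℝ] ℂ).integrable_comp hk
  have hre : (fun ω => (k ω).re) =ᵐ[ν] 0 := by
    refine ae_eq_zero_of_integral_freqExp_mul_ofReal hk.re fun t => ?_
    have : ∀ ω, freqExp t ω * ((k ω).re : ℂ) =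
        (2 : ℂ)⁻¹ * (freqExp t ω * k ω + freqExp t ω * (starRingEnd ℂ) (k ω)) := by
      intro ω
      rw [Complex.re_eq_add_conj]
      ring
    simp_rw [this]
    rw [integral_const_mul, integral_add (integrable_freqExp_mul hk t)
      (integrable_freqExp_mul hkc t), h, hconj]
    simp
  have him : (fun ω => (k ω).im) =ᵐ[ν] 0 := by
    refine ae_eq_zero_of_integral_freqExp_mul_ofReal hk.im fun t => ?_
    have : ∀ ω, freqExp t ω * ((k ω).im : ℂ) =
        (2 * Complex.I)⁻¹ * (freqExp t ω * k ω - freqExp t ω * (starRingEnd ℂ) (k ω)) := by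
      intro ω
      rw [Complex.im_eq_sub_conj]
      ring
    simp_rw [this]
    rw [integral_const_mul, integral_sub (integrable_freqExp_mul hk t)
      (integrable_freqExp_mul hkc t), h, hconj]
    simp
  filter_upwards [hre, him] with ω h1 h2
  exact Complex.ext h1 h2

/-- A function orthogonal to all characters has vanishing Fourier transform against `ν`, hence is
zero almost everywhere. -/
theorem span_l2Class_freqExp_dense (ν : Measure ℝ) [IsFiniteMeasure ν] :
    (Submodule.span ℂ (range fun t : ℝ => l2Class ν (freqExp t))).topologicalClosure = ⊤ := by
  rw [Submodule.topologicalClosure_eq_top_iff, Submodule.eq_bot_iff]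
  intro k hk
  have hk2 : MemLp (k : ℝ → ℂ) 2 ν := Lp.memLp k
  have h0 : (k : ℝ → ℂ) =ᵐ[ν] 0 := by
    refine ae_eq_zero_of_integral_freqExp_mul (hk2.integrable (by norm_num)) fun t => ?_
    have h1 := (Submodule.mem_orthogonal _ _).1 hk _ (Submodule.subset_span ⟨-t, rfl⟩)
    rw [← l2Class_coeFn k, inner_l2Class (memLp_freqExp ν _) hk2] at h1
    simpa [conj_freqExp] using h1
  exact (Lp.eq_zero_iff_ae_eq_zero).2 h0

/-- The trigonometric polynomial with given coefficients. -/
def trigPoly (p : ℝ →₀ ℂ) (ω : ℝ) : ℂ := ∑ t ∈ p.support, p t * freqExp t ω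

theorem memLp_trigPoly (ν : Measure ℝ) [IsFiniteMeasure ν] (p : ℝ →₀ ℂ) :
    MemLp (trigPoly p) 2 ν :=
  memLp_finsetSum _ fun t _ => (memLp_freqExp ν t).const_mul (p t)

theorem l2Class_trigPoly (ν : Measure ℝ) [IsFiniteMeasure ν] (p : ℝ →₀ ℂ) :
    l2Class ν (trigPoly p) = Finsupp.linearCombination ℂ (fun t => l2Class ν (freqExp t)) p := by
  have := l2Class_sum (ν := ν) p.support (φ := fun t ω => p t * freqExp t ω)
    fun t => (memLp_freqExp ν t).const_mul (p t)
  rw [Finsupp.linearCombination_apply, Finsupp.sum]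
  refine this.trans (Finset.sum_congr rfl fun t _ => ?_)
  exact l2Class_const_mul _ (memLp_freqExp ν t)

theorem exists_trigPoly_tendsto (ν : Measure ℝ) [IsFiniteMeasure ν] (φ : ℝ → ℂ) :
    ∃ p : ℕ → (ℝ →₀ ℂ),
      Tendsto (fun n => l2Class ν (trigPoly (p n))) atTop (𝓝 (l2Class ν φ)) := by
  have h : l2Class ν φ ∈
      (Submodule.span ℂ (range fun t : ℝ => l2Class ν (freqExp t))).topologicalClosure := by
    rw [span_l2Class_freqExp_dense]; trivial
  obtain ⟨x, hx, hlim⟩ := mem_closure_iff_seq_limit.1 h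
  have hx' : ∀ n, ∃ p, Finsupp.linearCombination ℂ (fun t => l2Class ν (freqExp t)) p = x n :=
    fun n => (Finsupp.mem_span_range_iff_exists_finsupp.1 (hx n))
  choose p hp using hx'
  refine ⟨p, ?_⟩
  simp_rw [l2Class_trigPoly, hp]
  exact hlim

/-- Approximating once with respect to a sum of measures gives an approximation for each summand. -/
theorem tendsto_l2Class_of_measure_le {α : Type*} [MeasurableSpace α] {ν ν' : Measure α}
    (hν : ν' ≤ ν) {φ : ℕ → α → ℂ} {ψ : α → ℂ} (hφ : ∀ n, MemLp (φ n) 2 ν) (hψ : MemLp ψ 2 ν)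
    (h : Tendsto (fun n => l2Class ν (φ n)) atTop (𝓝 (l2Class ν ψ))) :
    Tendsto (fun n => l2Class ν' (φ n)) atTop (𝓝 (l2Class ν' ψ)) := by
  rw [tendsto_iff_norm_sub_tendsto_zero] at h ⊢
  refine squeeze_zero (fun n => norm_nonneg _) (fun n => ?_) h
  have h2 : MemLp (fun x => φ n x - ψ x) 2 ν := (hφ n).sub hψ
  rw [← l2Class_sub (hφ n) hψ, ← l2Class_sub ((hφ n).mono_measure hν) (hψ.mono_measure hν),
    norm_l2Class h2, norm_l2Class (h2.mono_measure hν)]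
  exact ENNReal.toReal_mono h2.2.ne (eLpNorm_mono_measure _ hν)

theorem MeasureTheory.MemLp.mul_of_norm_le {α : Type*} [MeasurableSpace α] {ν : Measure α}
    {b φ : α → ℂ} {C : ℝ} (hφ : MemLp φ 2 ν) (hb : Measurable b) (hC : ∀ x, ‖b x‖ ≤ C) :
    MemLp (fun x => b x * φ x) 2 ν :=
  MemLp.of_le_mul (c := C) hφ (hb.aestronglyMeasurable.mul hφ.1)
    (Eventually.of_forall fun x => by rw [norm_mul]; gcongr; exact hC x)

theorem tendsto_l2Class_mul_left {α : Type*} [MeasurableSpace α] {ν : Measure α}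
    {b : α → ℂ} {C : ℝ} (hb : Measurable b) (hC : ∀ x, ‖b x‖ ≤ C)
    {φ : ℕ → α → ℂ} {ψ : α → ℂ} (hφ : ∀ n, MemLp (φ n) 2 ν) (hψ : MemLp ψ 2 ν)
    (h : Tendsto (fun n => l2Class ν (φ n)) atTop (𝓝 (l2Class ν ψ))) :
    Tendsto (fun n => l2Class ν fun x => b x * φ n x) atTop (𝓝 (l2Class ν fun x => b x * ψ x)) := by
  rw [tendsto_iff_norm_sub_tendsto_zero] at h ⊢
  refine squeeze_zero (fun n => norm_nonneg _) (fun n => ?_) (by simpa using h.const_mul |C|)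
  have h2 : MemLp (fun x => φ n x - ψ x) 2 ν := (hφ n).sub hψ
  have h3 := h2.mul_of_norm_le hb hC
  rw [← l2Class_sub ((hφ n).mul_of_norm_le hb hC) (hψ.mul_of_norm_le hb hC),
    ← l2Class_sub (hφ n) hψ]
  simp_rw [← mul_sub]
  rw [← abs_of_nonneg (norm_nonneg (l2Class ν fun x => b x * (φ n x - ψ x))),
    ← abs_of_nonneg (norm_nonneg (l2Class ν fun x => (φ n x - ψ x))), ← abs_mul]
  refine sq_le_sq.1 ?_
  rw [mul_pow, norm_sq_l2Class h3, norm_sq_l2Class h2, ← integral_const_mul]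
  refine integral_mono_of_nonneg (Eventually.of_forall fun x => by positivity)
    (((memLp_two_iff_integrable_sq_norm h2.1).1 h2).const_mul _)
    (Eventually.of_forall fun x => ?_)
  simp only [norm_mul, mul_pow]
  gcongr
  exact hC x

/-! ### Existence of the spectral measure of the generator -/

theorem norm_indicator_one_le {α : Type*} (s : Set α) (x : α) :
    ‖s.indicator (fun _ => (1 : ℂ)) x‖ ≤ 1 := by
  by_cases hx : x ∈ s <;> simp [hx]

theorem measurable_indicator_one {α : Type*} [MeasurableSpace α] {s : Set α}
    (hs : MeasurableSet s) : Measurable (s.indicator fun _ => (1 : ℂ)) :=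
  measurable_const.indicator hs

namespace IsUnitaryGroup

variable {H : Type*} [NormedAddCommGroup H] [InnerProductSpace ℂ H] [CompleteSpace H]
  {U : ℝ → H →L[ℂ] H}

/-- The measure whose characteristic function is `t ↦ ⟪f, U t f⟫`. -/
def coeffMeasure (hU : IsUnitaryGroup U) (f : H) : Measure ℝ :=
  (hU.exists_measure_charFun_eq f).choose

instance isFiniteMeasure_coeffMeasure (hU : IsUnitaryGroup U) (f : H) :
    IsFiniteMeasure (hU.coeffMeasure f) :=
  (hU.exists_measure_charFun_eq f).choose_spec.1

theorem integral_freqExp_coeffMeasure (hU : IsUnitaryGroup U) (f : H) (t : ℝ) :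
    ∫ ω, freqExp t ω ∂(hU.coeffMeasure f) = ⟪f, U t f⟫_ℂ := by
  rw [← (hU.exists_measure_charFun_eq f).choose_spec.2 t, charFun_apply_real]
  rfl

/-- Both Gram matrices have the entries `∫ e^{i(t-s)ω} dν = ⟪f, U (t - s) f⟫`. -/
theorem exists_isometry (hU : IsUnitaryGroup U) (f : H) :
    ∃ J : Lp ℂ 2 (hU.coeffMeasure f) →ₗᵢ[ℂ] H,
      ∀ t, J (l2Class (hU.coeffMeasure f) (freqExp t)) = U t f := by
  refine exists_linearIsometry_of_inner_eq _ _ (span_l2Class_freqExp_dense _) fun s t => ?_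
  rw [inner_l2Class (memLp_freqExp _ s) (memLp_freqExp _ t), hU.inner_apply_left, ← hU.map_add,
    ← hU.integral_freqExp_coeffMeasure]
  simp_rw [conj_freqExp, ← freqExp_add]

/-- The isometric embedding of `L²` that sends the characters to the orbit of `f`. -/
def isometry (hU : IsUnitaryGroup U) (f : H) : Lp ℂ 2 (hU.coeffMeasure f) →ₗᵢ[ℂ] H :=
  (hU.exists_isometry f).choose

/-- The vector `φ(V / i) f`, where `V` is the generator. -/
def funcInt (hU : IsUnitaryGroup U) (f : H) (φ : ℝ → ℂ) : H :=
  hU.isometry f (l2Class (hU.coeffMeasure f) φ)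

theorem funcInt_freqExp (hU : IsUnitaryGroup U) (f : H) (t : ℝ) :
    hU.funcInt f (freqExp t) = U t f := (hU.exists_isometry f).choose_spec t

theorem funcInt_one (hU : IsUnitaryGroup U) (f : H) : hU.funcInt f (fun _ => 1) = f := by
  have := hU.funcInt_freqExp f 0
  rwa [funext freqExp_zero, hU.map_zero] at this

theorem inner_self_funcInt (hU : IsUnitaryGroup U) {f : H} {φ : ℝ → ℂ}
    (hφ : MemLp φ 2 (hU.coeffMeasure f)) :
    ⟪f, hU.funcInt f φ⟫_ℂ = ∫ ω, φ ω ∂(hU.coeffMeasure f) := by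
  conv_lhs => enter [2]; rw [← hU.funcInt_one f]
  rw [funcInt, funcInt, LinearIsometry.inner_map_map, inner_l2Class (memLp_const 1) hφ]
  simp

theorem norm_sq_funcInt (hU : IsUnitaryGroup U) {f : H} {φ : ℝ → ℂ}
    (hφ : MemLp φ 2 (hU.coeffMeasure f)) :
    ‖hU.funcInt f φ‖ ^ 2 = ∫ ω, ‖φ ω‖ ^ 2 ∂(hU.coeffMeasure f) := by
  rw [funcInt, LinearIsometry.norm_map, norm_sq_l2Class hφ]

/-- The operator `p(V / i)` for a trigonometric polynomial `p`. -/
def trigOp (U : ℝ → H →L[ℂ] H) (p : ℝ →₀ ℂ) : H →L[ℂ] H := ∑ t ∈ p.support, p t • U t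

theorem funcInt_trigPoly (hU : IsUnitaryGroup U) (f : H) (p : ℝ →₀ ℂ) :
    hU.funcInt f (trigPoly p) = trigOp U p f := by
  rw [funcInt, l2Class_trigPoly, Finsupp.linearCombination_apply, Finsupp.sum, map_sum, trigOp,
    sum_apply]
  refine Finset.sum_congr rfl fun t _ => ?_
  rw [map_smul, smul_apply, ← hU.funcInt_freqExp f t]
  rfl

/-- Approximation of `φ` by trigonometric polynomials in `L²(ν)` approximates `φ(V / i) f`
whenever `ν` dominates the measure of `f`. -/
theorem tendsto_trigOp (hU : IsUnitaryGroup U) {f : H} {φ : ℝ → ℂ} {ν : Measure ℝ}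
    [IsFiniteMeasure ν] (hν : hU.coeffMeasure f ≤ ν) (hφ : MemLp φ 2 ν) {p : ℕ → (ℝ →₀ ℂ)}
    (hp : Tendsto (fun n => l2Class ν (trigPoly (p n))) atTop (𝓝 (l2Class ν φ))) :
    Tendsto (fun n => trigOp U (p n) f) atTop (𝓝 (hU.funcInt f φ)) := by
  simp_rw [← hU.funcInt_trigPoly]
  exact ((hU.isometry f).continuous.tendsto _).comp
    (tendsto_l2Class_of_measure_le hν (fun n => memLp_trigPoly ν _) hφ hp)

variable {φ k : ℝ → ℂ} {C D : ℝ}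

/-- One sequence of trigonometric polynomials approximates `φ` for all three vectors, and each
`trigOp` is linear. -/
theorem funcInt_vec_add (hU : IsUnitaryGroup U) (f g : H) (hφ : Measurable φ)
    (hC : ∀ ω, ‖φ ω‖ ≤ C) : hU.funcInt (f + g) φ = hU.funcInt f φ + hU.funcInt g φ := by
  let ν := hU.coeffMeasure f + hU.coeffMeasure g + hU.coeffMeasure (f + g)
  have hφν : MemLp φ 2 ν := memLp_two_of_norm_le hφ.aestronglyMeasurable hC
  obtain ⟨p, hp⟩ := exists_trigPoly_tendsto ν φ
  have h1 := hU.tendsto_trigOp (f := f) (Measure.le_add_right (Measure.le_add_right le_rfl)) hφν hp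
  have h2 := hU.tendsto_trigOp (f := g) (Measure.le_add_right (Measure.le_add_left le_rfl)) hφν hp
  have h3 := hU.tendsto_trigOp (f := f + g) (Measure.le_add_left le_rfl) hφν hp
  exact tendsto_nhds_unique h3 ((h1.add h2).congr fun n => (_root_.map_add (trigOp U (p n)) f g).symm)

theorem funcInt_vec_smul (hU : IsUnitaryGroup U) (c : ℂ) (f : H) (hφ : Measurable φ)
    (hC : ∀ ω, ‖φ ω‖ ≤ C) : hU.funcInt (c • f) φ = c • hU.funcInt f φ := by
  let ν := hU.coeffMeasure f + hU.coeffMeasure (c • f)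
  have hφν : MemLp φ 2 ν := memLp_two_of_norm_le hφ.aestronglyMeasurable hC
  obtain ⟨p, hp⟩ := exists_trigPoly_tendsto ν φ
  have h1 := hU.tendsto_trigOp (f := f) (Measure.le_add_right le_rfl) hφν hp
  have h2 := hU.tendsto_trigOp (f := c • f) (Measure.le_add_left le_rfl) hφν hp
  simp_rw [map_smul] at h2
  exact tendsto_nhds_unique h2 (h1.const_smul c)

theorem map_funcInt (hU : IsUnitaryGroup U) (f : H) (t : ℝ)
    (hk : MemLp k 2 (hU.coeffMeasure f)) :
    U t (hU.funcInt f k) = hU.funcInt f fun ω => freqExp t ω * k ω := by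
  have htrig : ∀ p, U t (hU.funcInt f (trigPoly p)) =
      hU.funcInt f fun ω => freqExp t ω * trigPoly p ω := by
    intro p
    have h1 : l2Class (hU.coeffMeasure f) (fun ω => freqExp t ω * trigPoly p ω) =
        ∑ s ∈ p.support, p s • l2Class (hU.coeffMeasure f) (freqExp (t + s)) := by
      have h2 := l2Class_sum (ν := hU.coeffMeasure f) p.support
        (φ := fun s ω => p s * freqExp (t + s) ω) fun s => (memLp_freqExp _ (t + s)).const_mul (p s)
      rw [← Finset.sum_congr rfl fun s _ => l2Class_const_mul (p s) (memLp_freqExp _ (t + s)), ← h2]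
      congr 1
      ext ω
      rw [trigPoly, Finset.mul_sum]
      refine Finset.sum_congr rfl fun s _ => ?_
      rw [freqExp_add]
      ring
    rw [funcInt_trigPoly, funcInt, h1, map_sum, trigOp, sum_apply, map_sum]
    refine Finset.sum_congr rfl fun s _ => ?_
    rw [smul_apply, map_smul, map_smul, ← hU.map_add, ← hU.funcInt_freqExp f]
    rfl
  obtain ⟨p, hp⟩ := exists_trigPoly_tendsto (hU.coeffMeasure f) k
  have h1 := ((U t).continuous.tendsto _).comp (((hU.isometry f).continuous.tendsto _).comp hp)
  have h2 := ((hU.isometry f).continuous.tendsto _).comp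
    (tendsto_l2Class_mul_left (measurable_freqExp t) (fun ω => (norm_freqExp t ω).le)
      (fun n => memLp_trigPoly _ (p n)) hk hp)
  refine tendsto_nhds_unique h1 (h2.congr fun n => ?_)
  exact (htrig (p n)).symm

theorem trigOp_funcInt (hU : IsUnitaryGroup U) (f : H) (p : ℝ →₀ ℂ)
    (hk : MemLp k 2 (hU.coeffMeasure f)) :
    trigOp U p (hU.funcInt f k) = hU.funcInt f fun ω => k ω * trigPoly p ω := by
  have hm : ∀ t, MemLp (fun ω => freqExp t ω * k ω) 2 (hU.coeffMeasure f) := fun t =>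
    hk.mul_of_norm_le (measurable_freqExp t) fun ω => (norm_freqExp t ω).le
  have h2 := l2Class_sum (ν := hU.coeffMeasure f) p.support
    (φ := fun t ω => p t * (freqExp t ω * k ω)) fun t => (hm t).const_mul (p t)
  have h3 : (fun ω => k ω * trigPoly p ω) =
      fun ω => ∑ t ∈ p.support, p t * (freqExp t ω * k ω) := by
    ext ω
    rw [trigPoly, Finset.mul_sum]
    exact Finset.sum_congr rfl fun s _ => by ring
  rw [h3, funcInt.eq_def hU f fun ω => ∑ t ∈ p.support, _, h2, map_sum, trigOp, sum_apply]
  refine Finset.sum_congr rfl fun t _ => ?_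
  rw [smul_apply, hU.map_funcInt f t hk, l2Class_const_mul _ (hm t), map_smul]
  rfl

/-- Trigonometric polynomials of the group act as multiplication (`trigOp_funcInt`). Approximate `φ`
by them for `f` and for `funcInt f k` simultaneously. -/
theorem funcInt_funcInt (hU : IsUnitaryGroup U) (f : H) (hφ : Measurable φ)
    (hC : ∀ ω, ‖φ ω‖ ≤ C) (hk : Measurable k) (hD : ∀ ω, ‖k ω‖ ≤ D) :
    hU.funcInt (hU.funcInt f k) φ = hU.funcInt f fun ω => k ω * φ ω := by
  let ν := hU.coeffMeasure f + hU.coeffMeasure (hU.funcInt f k)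
  have hφν : MemLp φ 2 ν := memLp_two_of_norm_le hφ.aestronglyMeasurable hC
  obtain ⟨p, hp⟩ := exists_trigPoly_tendsto ν φ
  have h1 := hU.tendsto_trigOp (f := hU.funcInt f k) (Measure.le_add_left le_rfl) hφν hp
  have h2 := ((hU.isometry f).continuous.tendsto _).comp
    (tendsto_l2Class_mul_left hk hD (fun n => memLp_trigPoly _ (p n))
      (memLp_two_of_norm_le hφ.aestronglyMeasurable hC)
      (tendsto_l2Class_of_measure_le (Measure.le_add_right le_rfl)
        (fun n => memLp_trigPoly ν (p n)) hφν hp))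
  refine tendsto_nhds_unique h1 (h2.congr fun n => ?_)
  exact (hU.trigOp_funcInt f (p n)
    (memLp_two_of_norm_le hk.aestronglyMeasurable hD)).symm

theorem norm_funcInt_le (hU : IsUnitaryGroup U) (f : H) (hφ : Measurable φ)
    (hC : ∀ ω, ‖φ ω‖ ≤ 1) : ‖hU.funcInt f φ‖ ≤ ‖f‖ := by
  rw [← sq_le_sq₀ (norm_nonneg _) (norm_nonneg _)]
  conv_rhs => rw [← hU.funcInt_one f]
  rw [hU.norm_sq_funcInt (memLp_const 1),
    hU.norm_sq_funcInt (memLp_two_of_norm_le hφ.aestronglyMeasurable hC)]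
  refine integral_mono_of_nonneg (Eventually.of_forall fun ω => by positivity)
    (integrable_const _) (Eventually.of_forall fun ω => ?_)
  simpa using hC ω

open Classical in
/-- The spectral projections of a unitary group. -/
def spectralProj (hU : IsUnitaryGroup U) (s : Set ℝ) : H →L[ℂ] H :=
  if hs : MeasurableSet s then
    LinearMap.mkContinuous
      { toFun := fun f => hU.funcInt f (s.indicator fun _ => 1)
        map_add' := fun f g =>
          hU.funcInt_vec_add f g (measurable_indicator_one hs) (norm_indicator_one_le s)
        map_smul' := fun c f =>
          hU.funcInt_vec_smul c f (measurable_indicator_one hs) (norm_indicator_one_le s) }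
      1 fun f => by
        rw [one_mul]
        exact hU.norm_funcInt_le f (measurable_indicator_one hs) (norm_indicator_one_le s)
  else 0

theorem spectralProj_apply (hU : IsUnitaryGroup U) {s : Set ℝ} (hs : MeasurableSet s) (f : H) :
    hU.spectralProj s f = hU.funcInt f (s.indicator fun _ => 1) := by
  rw [spectralProj, dif_pos hs]
  rfl

theorem spectralProj_inter (hU : IsUnitaryGroup U) {s t : Set ℝ} (hs : MeasurableSet s)
    (ht : MeasurableSet t) : hU.spectralProj (s ∩ t) = hU.spectralProj s * hU.spectralProj t := by
  ext f
  rw [mul_apply_eq_comp, hU.spectralProj_apply (hs.inter ht), hU.spectralProj_apply ht,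
    hU.spectralProj_apply hs, hU.funcInt_funcInt f (measurable_indicator_one hs)
      (norm_indicator_one_le s) (measurable_indicator_one ht) (norm_indicator_one_le t)]
  congr 1
  ext ω
  by_cases h1 : ω ∈ s <;> by_cases h2 : ω ∈ t <;> simp [h1, h2]

/-- Idempotence is multiplicativity with `s = t`; self-adjointness follows since the quadratic form
is the real number `ν(s)`. -/
theorem isStarProjection_spectralProj (hU : IsUnitaryGroup U) {s : Set ℝ}
    (hs : MeasurableSet s) : IsStarProjection (hU.spectralProj s) := by
  refine ⟨?_, ?_⟩
  · rw [IsIdempotentElem, ← hU.spectralProj_inter hs hs, inter_self]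
  · rw [ContinuousLinearMap.isSelfAdjoint_iff_isSymmetric,
      LinearMap.isSymmetric_iff_inner_map_self_real]
    intro f
    change (starRingEnd ℂ) ⟪hU.spectralProj s f, f⟫_ℂ = ⟪hU.spectralProj s f, f⟫_ℂ
    have h : ⟪f, hU.spectralProj s f⟫_ℂ = ((hU.coeffMeasure f).real s : ℂ) := by
      rw [hU.spectralProj_apply hs, hU.inner_self_funcInt
        (ProjectionValuedMeasure.memLp_indicator_one hs), integral_indicator_const _ hs]
      simp
    rw [inner_conj_symm, h, ← inner_conj_symm, h, Complex.conj_ofReal]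

/-- By disjointness finite sums of indicators are indicators of finite unions, so dominated
convergence applies along finite subsets with bound `1`. -/
theorem hasSum_spectralProj (hU : IsUnitaryGroup U) (s : ℕ → Set ℝ)
    (hs : ∀ i, MeasurableSet (s i)) (hd : Pairwise (Function.onFun Disjoint s)) (f : H) :
    HasSum (fun i => hU.spectralProj (s i) f) (hU.spectralProj (⋃ i, s i) f) := by
  classical
  have hmem : ∀ i, MemLp ((s i).indicator fun _ => (1 : ℂ)) 2 (hU.coeffMeasure f) := fun i =>
    ProjectionValuedMeasure.memLp_indicator_one (hs i)
  have hfin : ∀ F : Finset ℕ, (fun ω => ∑ i ∈ F, (s i).indicator (fun _ => (1 : ℂ)) ω) =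
      (⋃ i ∈ F, s i).indicator fun _ => 1 := by
    intro F
    ext ω
    rw [Finset.indicator_biUnion]
    intro i _ j _ hij
    exact hd hij
  have h := tendsto_l2Class_of_dominated (ν := hU.coeffMeasure f) (l := (atTop : Filter (Finset ℕ)))
    (φ := fun F ω => ∑ i ∈ F, (s i).indicator (fun _ => (1 : ℂ)) ω)
    (ψ := (⋃ i, s i).indicator fun _ => 1) (G := fun _ => 1)
    (fun F => ?_) ?_ (memLp_const 1) (Eventually.of_forall fun F ω => ?_)
    (norm_indicator_one_le _) fun ω => ?_
  · have h2 := ((hU.isometry f).continuous.tendsto _).comp h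
    rw [HasSum, hU.spectralProj_apply (MeasurableSet.iUnion hs), SummationFilter.unconditional_filter]
    refine h2.congr fun F => ?_
    simp only [Function.comp]
    rw [l2Class_sum F hmem, map_sum]
    exact Finset.sum_congr rfl fun i _ => (hU.spectralProj_apply (hs i) f).symm
  · exact (Finset.measurable_sum F fun i _ => measurable_indicator_one (hs i)).aestronglyMeasurable
  · exact (measurable_indicator_one (MeasurableSet.iUnion hs)).aestronglyMeasurable
  · rw [congrFun (hfin F) ω]
    exact norm_indicator_one_le _ ω
  · rw [funext fun F => congrFun (hfin F) ω]
    by_cases hω : ω ∈ ⋃ i, s i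
    · obtain ⟨i, hi⟩ := mem_iUnion.1 hω
      refine tendsto_const_nhds.congr' ?_
      filter_upwards [eventually_ge_atTop {i}] with F hF
      rw [indicator_of_mem hω, indicator_of_mem]
      exact mem_biUnion (Finset.singleton_subset_iff.1 hF) hi
    · refine tendsto_const_nhds.congr fun F => ?_
      rw [indicator_of_notMem hω, indicator_of_notMem]
      exact fun h => hω (iUnion₂_subset_iUnion _ _ h)

/-- The projection-valued measure of a unitary group. -/
def spectralMeasure (hU : IsUnitaryGroup U) : ProjectionValuedMeasure ℝ H where
  proj := hU.spectralProj
  isStarProjection _ hs := hU.isStarProjection_spectralProj hs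
  proj_empty := by
    ext f
    rw [hU.spectralProj_apply MeasurableSet.empty, indicator_empty, funcInt, l2Class_zero, _root_.map_zero]
    rfl
  proj_univ := by
    ext f
    rw [hU.spectralProj_apply MeasurableSet.univ, indicator_univ, hU.funcInt_one]
    rfl
  proj_inter _ _ hs ht := hU.spectralProj_inter hs ht
  hasSum_proj := hU.hasSum_spectralProj

theorem scalarMeasure_spectralMeasure (hU : IsUnitaryGroup U) (f : H) :
    hU.spectralMeasure.scalarMeasure f = hU.coeffMeasure f := by
  ext s hs
  have hm : MemLp (s.indicator fun _ => (1 : ℂ)) 2 (hU.coeffMeasure f) :=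
    ProjectionValuedMeasure.memLp_indicator_one hs
  have h : ‖hU.spectralProj s f‖ ^ 2 = (hU.coeffMeasure f).real s := by
    rw [hU.spectralProj_apply hs, hU.norm_sq_funcInt hm]
    have : (fun ω => ‖s.indicator (fun _ => (1 : ℂ)) ω‖ ^ 2) = s.indicator fun _ => (1 : ℝ) := by
      ext ω
      by_cases hω : ω ∈ s <;> simp [hω]
    rw [this, integral_indicator_const _ hs]
    simp
  rw [ProjectionValuedMeasure.scalarMeasure_apply _ _ hs]
  change ENNReal.ofReal (‖hU.spectralProj s f‖ ^ 2) = _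
  rw [h, ofReal_measureReal]

theorem funcInt_freqExp_slope (hU : IsUnitaryGroup U) (f : H) (s : ℝ) :
    hU.funcInt f (fun ω => ((s⁻¹ : ℝ) : ℂ) * (freqExp (0 + s) ω - freqExp 0 ω)) =
      ((s⁻¹ : ℝ) : ℂ) • (U s f - f) := by
  have h0 := hU.funcInt_freqExp f 0
  rw [hU.map_zero] at h0
  have hm : MemLp (fun ω => freqExp (0 + s) ω - freqExp 0 ω) 2 (hU.coeffMeasure f) :=
    (memLp_freqExp _ (0 + s)).sub (memLp_freqExp _ 0)
  rw [funcInt, l2Class_const_mul _ hm, map_smul, l2Class_sub (memLp_freqExp _ (0 + s)) (memLp_freqExp _ 0), map_sub, zero_add]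
  change _ • (hU.funcInt f (freqExp s) - hU.funcInt f (freqExp 0)) = _
  rw [h0, hU.funcInt_freqExp]

theorem hasGeneratorAt_funcInt (hU : IsUnitaryGroup U) {f : H}
    (hf : MemLp (fun ω : ℝ => Complex.I * (ω : ℂ)) 2 (hU.coeffMeasure f)) :
    HasGeneratorAt U f (hU.funcInt f fun ω : ℝ => Complex.I * (ω : ℂ)) := by
  have h := ((hU.isometry f).continuous.tendsto _).comp (tendsto_l2Class_freqExp_slope hf 0)
  simp only [freqExp_zero, mul_one] at h
  refine h.congr fun s => ?_
  have := hU.funcInt_freqExp_slope f s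
  simp only [freqExp_zero] at this
  exact this

/-- Fatou's lemma for `|(e^{iωu} - 1)/u|²` as `u → 0`: its integrals are the squared norms of the
difference quotients, which tend to `‖g‖²`. -/
theorem lintegral_freq_lt_top (hU : IsUnitaryGroup U) {f g : H} (h : HasGeneratorAt U f g) :
    ∫⁻ ω, ENNReal.ofReal (‖Complex.I * (ω : ℂ)‖ ^ 2) ∂(hU.coeffMeasure f) < ∞ := by
  let u : ℕ → ℝ := fun n => 1 / ((n : ℝ) + 1)
  have hu : Tendsto u atTop (𝓝[≠] 0) :=
    tendsto_nhdsWithin_iff.2 ⟨tendsto_one_div_add_atTop_nhds_zero_nat,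
      Eventually.of_forall fun n => (show u n ≠ 0 by simp only [u]; positivity)⟩
  let q : ℕ → ℝ → ℂ := fun n ω =>
    (((u n)⁻¹ : ℝ) : ℂ) * (freqExp (0 + u n) ω - freqExp 0 ω)
  have hqm : ∀ n, Measurable (q n) := fun n =>
    ((measurable_freqExp _).sub (measurable_freqExp _)).const_mul _
  have hq2 : ∀ n, MemLp (q n) 2 (hU.coeffMeasure f) := fun n =>
    ((memLp_freqExp _ _).sub (memLp_freqExp _ _)).const_mul _
  have hlim : ∀ ω : ℝ, Tendsto (fun n => ENNReal.ofReal (‖q n ω‖ ^ 2)) atTop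
      (𝓝 (ENNReal.ofReal (‖Complex.I * (ω : ℂ)‖ ^ 2))) := by
    intro ω
    have := (tendsto_freqExp_slope 0 ω).comp hu
    rw [freqExp_zero ω, mul_one] at this
    simp only [q, freqExp_zero] at this ⊢
    exact ENNReal.tendsto_ofReal (this.norm.pow 2)
  have hint : Tendsto (fun n => ∫⁻ ω, ENNReal.ofReal (‖q n ω‖ ^ 2) ∂(hU.coeffMeasure f)) atTop
      (𝓝 (ENNReal.ofReal (‖g‖ ^ 2))) := by
    refine (ENNReal.tendsto_ofReal ((h.comp hu).norm.pow 2)).congr fun n => ?_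
    rw [← ofReal_integral_eq_lintegral_ofReal
      ((memLp_two_iff_integrable_sq_norm (hq2 n).1).1 (hq2 n))
      (Eventually.of_forall fun ω => by positivity), ← hU.norm_sq_funcInt (hq2 n),
      hU.funcInt_freqExp_slope]
    rfl
  calc ∫⁻ ω, ENNReal.ofReal (‖Complex.I * (ω : ℂ)‖ ^ 2) ∂(hU.coeffMeasure f)
      = ∫⁻ ω, liminf (fun n => ENNReal.ofReal (‖q n ω‖ ^ 2)) atTop ∂(hU.coeffMeasure f) :=
        lintegral_congr fun ω => ((hlim ω).liminf_eq).symm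
    _ ≤ liminf (fun n => ∫⁻ ω, ENNReal.ofReal (‖q n ω‖ ^ 2) ∂(hU.coeffMeasure f)) atTop :=
        lintegral_liminf_le fun n => ((hqm n).norm.pow_const 2).ennreal_ofReal
    _ = ENNReal.ofReal (‖g‖ ^ 2) := hint.liminf_eq
    _ < ∞ := ENNReal.ofReal_lt_top

/-- **Stone's theorem**: the generator of a strongly continuous unitary group has a spectral
measure on the imaginary axis. -/
theorem isSpectralMeasureOf_generator (hU : IsUnitaryGroup U) :
    hU.spectralMeasure.IsSpectralMeasureOf (fun ω : ℝ => Complex.I * (ω : ℂ)) (generator U) := by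
  have hiff : ∀ f : H, f ∈ (generator U).domain ↔
      ∫⁻ ω : ℝ, ENNReal.ofReal (‖Complex.I * (ω : ℂ)‖ ^ 2) ∂(hU.coeffMeasure f) < ∞ := fun f =>
    ⟨fun ⟨_, hg⟩ => hU.lintegral_freq_lt_top hg, fun h => ⟨_, hU.hasGeneratorAt_funcInt
      (memLp_two_of_lintegral_lt_top measurable_freq.aestronglyMeasurable h)⟩⟩
  refine ⟨fun f => ?_, fun f => ?_⟩
  · rw [hU.scalarMeasure_spectralMeasure, hiff]
  · have hf := memLp_two_of_lintegral_lt_top measurable_freq.aestronglyMeasurable ((hiff f).1 f.2)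
    rw [hU.scalarMeasure_spectralMeasure, generator_apply (hU.hasGeneratorAt_funcInt hf) f.2,
      hU.inner_self_funcInt hf]

end IsUnitaryGroup

/-! ### The Koopman group -/

section KoopmanGroup

section

variable {X : Type*} [TopologicalSpace X] [MeasurableSpace X] {Φ : Flow ℝ X} {μ : Measure X}

theorem coeFn_koopman (hΦ : IsErgodicFlow Φ μ) (t : ℝ) (f : Lp ℂ 2 μ) :
    koopman hΦ t f =ᵐ[μ] f ∘ Φ t :=
  Lp.coeFn_compMeasurePreserving f (hΦ.measurePreserving t)

theorem norm_koopman (hΦ : IsErgodicFlow Φ μ) (t : ℝ) (f : Lp ℂ 2 μ) :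
    ‖koopman hΦ t f‖ = ‖f‖ :=
  (Lp.compMeasurePreservingₗᵢ ℂ (Φ t) (hΦ.measurePreserving t)).norm_map f

theorem koopman_l2Class (hΦ : IsErgodicFlow Φ μ) (t : ℝ) {b : X → ℂ} (hb : MemLp b 2 μ) :
    koopman hΦ t (l2Class μ b) = l2Class μ (b ∘ Φ t) := by
  have hm : MemLp (b ∘ Φ t) 2 μ := hb.comp_measurePreserving (hΦ.measurePreserving t)
  refine Lp.ext ?_
  exact (coeFn_koopman hΦ t _).trans (((hΦ.measurePreserving t).quasiMeasurePreserving.ae_eq_comp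
    (coeFn_l2Class hb)).trans (coeFn_l2Class hm).symm)

end

variable {X : Type*} [MetricSpace X] [MeasurableSpace X] [BorelSpace X] {Φ : Flow ℝ X}
  {μ : Measure X} [IsProbabilityMeasure μ]

theorem continuous_koopman_boundedContinuous (hΦ : IsErgodicFlow Φ μ)
    (b : BoundedContinuousFunction X ℂ) : Continuous fun t => koopman hΦ t (l2Class μ b) := by
  have hb : MemLp b 2 μ := memLp_two_of_norm_le b.continuous.aestronglyMeasurable b.norm_coe_le_norm
  simp_rw [koopman_l2Class hΦ _ hb]
  have hc : ∀ t, Continuous (b ∘ Φ t) := fun t =>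
    b.continuous.comp (Φ.continuous continuous_const continuous_id)
  refine continuous_iff_continuousAt.2 fun t => ?_
  refine tendsto_l2Class_of_dominated (G := fun _ => ‖b‖)
    (fun s => (hc s).aestronglyMeasurable) (hc t).aestronglyMeasurable (memLp_const _)
    (Eventually.of_forall fun s x => b.norm_coe_le_norm _) (fun x => b.norm_coe_le_norm _)
    fun x => ?_
  exact (b.continuous.comp (Φ.continuous continuous_id continuous_const)).tendsto t

/-- Bounded continuous functions are dense in `L²`, and the operators are isometries, so the orbit
of `f` is a uniform limit of continuous orbits. -/
theorem continuous_koopman (hΦ : IsErgodicFlow Φ μ) (f : Lp ℂ 2 μ) :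
    Continuous fun t => koopman hΦ t f := by
  refine continuous_of_uniform_approx_of_continuous fun u hu => ?_
  obtain ⟨ε, hε, hεu⟩ := Metric.mem_uniformity_dist.1 hu
  obtain ⟨g, hg, hfg⟩ := Metric.dense_iff.1
    (Lp.boundedContinuousFunction_dense ℂ μ (p := 2) (by norm_num)) f ε hε
  obtain ⟨b, hb⟩ := Lp.mem_boundedContinuousFunction_iff.1 hfg
  have hbm : MemLp b 2 μ := memLp_two_of_norm_le b.continuous.aestronglyMeasurable b.norm_coe_le_norm
  have hgb : g = l2Class μ b := by
    refine Lp.ext ?_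
    have h1 : (g : X → ℂ) =ᵐ[μ] b := by
      rw [← hb]
      exact b.toContinuousMap.coeFn_toAEEqFun μ
    exact h1.trans (coeFn_l2Class hbm).symm
  refine ⟨_, continuous_koopman_boundedContinuous hΦ b, fun t => hεu ?_⟩
  rw [← hgb, dist_eq_norm, ← map_sub, norm_koopman, ← dist_eq_norm]
  exact Metric.mem_ball'.1 hg

theorem isUnitaryGroup_koopman (hΦ : IsErgodicFlow Φ μ) : IsUnitaryGroup (koopman hΦ) where
  map_zero f := by
    refine Lp.ext ((coeFn_koopman hΦ 0 f).trans ?_)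
    rw [Φ.map_zero]
    rfl
  map_add s t f := by
    refine Lp.ext ((coeFn_koopman hΦ (s + t) f).trans ?_)
    refine Filter.EventuallyEq.symm ((coeFn_koopman hΦ s _).trans ?_)
    refine ((hΦ.measurePreserving s).quasiMeasurePreserving.ae_eq_comp
      (coeFn_koopman hΦ t f)).trans (Eventually.of_forall fun x => ?_)
    simp only [Function.comp]
    -- Composition reverses the order of the two flow maps, which is harmless because time addition
    -- commutes.
    rw [add_comm, Φ.map_add]
  norm_map t f := norm_koopman hΦ t f
  continuous_apply f := continuous_koopman hΦ f

end KoopmanGroup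

/-! ### Fourier synthesis of functions of the generator -/

theorem continuous_l2Class_freqExp (ν : Measure ℝ) [IsFiniteMeasure ν] :
    Continuous fun t => l2Class ν (freqExp t) :=
  continuous_iff_continuousAt.2 fun t => tendsto_l2Class_of_dominated (G := fun _ => 1)
    (fun s => (measurable_freqExp s).aestronglyMeasurable)
    (measurable_freqExp t).aestronglyMeasurable (memLp_const 1)
    (Eventually.of_forall fun s ω => (norm_freqExp s ω).le) (fun ω => (norm_freqExp t ω).le)
    fun ω => (continuous_freqExp_left ω).tendsto t

theorem norm_l2Class_freqExp_le (ν : Measure ℝ) [IsFiniteMeasure ν] (t : ℝ) :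
    ‖l2Class ν (freqExp t)‖ ≤ ‖l2Class ν (freqExp 0)‖ := by
  refine le_of_eq ?_
  rw [← sq_eq_sq₀ (norm_nonneg _) (norm_nonneg _), norm_sq_l2Class (memLp_freqExp ν t),
    norm_sq_l2Class (memLp_freqExp ν 0)]
  simp_rw [norm_freqExp]

theorem integrable_smul_l2Class_freqExp (ν : Measure ℝ) [IsFiniteMeasure ν] {k : ℝ → ℂ}
    (hk : Integrable k) : Integrable fun t => k t • l2Class ν (freqExp t) := by
  refine (hk.norm.mul_const ‖l2Class ν (freqExp 0)‖).mono'
    (hk.1.smul (continuous_l2Class_freqExp ν).aestronglyMeasurable)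
    (Eventually.of_forall fun t => ?_)
  rw [norm_smul]
  gcongr
  exact norm_l2Class_freqExp_le ν t

/-- A weighted integral of characters in `L²` is computed pointwise. -/
theorem integral_smul_l2Class_freqExp (ν : Measure ℝ) [IsFiniteMeasure ν] {k : ℝ → ℂ}
    (hk : Integrable k) {ψ : ℝ → ℂ} (hψ : MemLp ψ 2 ν) (h : ∀ ω, ∫ t, k t * freqExp t ω = ψ ω) :
    ∫ t, k t • l2Class ν (freqExp t) = l2Class ν ψ := by
  -- Pairing with an arbitrary `w` turns the vector-valued integral into a double integral of
  -- scalars, where Fubini applies.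
  refine ext_inner_left ℂ fun w => ?_
  have hw : MemLp w 2 ν := Lp.memLp w
  have hwi : Integrable (fun ω => (starRingEnd ℂ) (w ω)) ν :=
    (Complex.conjCLE : ℂ →L[ℝ] ℂ).integrable_comp (hw.integrable (by norm_num))
  rw [← integral_inner (integrable_smul_l2Class_freqExp ν hk)]
  have h1 : ∀ t, ⟪w, k t • l2Class ν (freqExp t)⟫_ℂ =
      ∫ ω, (starRingEnd ℂ) (w ω) * (k t * freqExp t ω) ∂ν := by
    intro t
    rw [inner_smul_right, ← l2Class_coeFn w, inner_l2Class hw (memLp_freqExp ν t),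
      ← integral_const_mul, l2Class_coeFn]
    congr 1
    ext ω
    ring
  simp_rw [h1]
  rw [integral_integral_swap]
  · conv_rhs => rw [← l2Class_coeFn w]
    rw [inner_l2Class hw hψ]
    congr 1
    ext ω
    rw [integral_const_mul, h]
  · have h2 : Integrable (fun p : ℝ × ℝ => k p.1 * (starRingEnd ℂ) (w p.2)) (volume.prod ν) :=
      hk.mul_prod hwi
    refine (h2.bdd_mul (c := 1) continuous_freqExp_uncurry.aestronglyMeasurable
      (Eventually.of_forall fun p => (norm_freqExp _ _).le)).congr
      (Eventually.of_forall fun p => ?_)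
    simp only [Function.uncurry]
    ring

/-! ### Fourier inversion for smooth windows -/

section FourierWindow

open FourierTransform

/-- The transform `t ↦ ∫ η(ω) e^{-iωt} dω` of a window `η`. -/
def windowTransform (η : ℝ → ℝ) (t : ℝ) : ℂ :=
  ∫ ω : ℝ, (η ω : ℂ) * Complex.exp (-(Complex.I * (ω : ℂ) * (t : ℂ)))

variable {η : ℝ → ℝ}

theorem windowTransform_eq_fourier (η : ℝ → ℝ) (t : ℝ) :
    windowTransform η t = 𝓕 (fun ω => (η ω : ℂ)) (t / (2 * Real.pi)) := by
  rw [windowTransform, Real.fourier_real_eq_integral_exp_smul]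
  congr 1
  ext ω
  rw [smul_eq_mul, mul_comm]
  congr 2
  have : (Real.pi : ℂ) ≠ 0 := by exact_mod_cast Real.pi_ne_zero
  push_cast
  field_simp

/-- A smooth compactly supported function is Schwartz, and so is its transform. -/
theorem integrable_fourier_window (hη : ContDiff ℝ ((⊤ : ℕ∞) : WithTop ℕ∞) η)
    (hc : HasCompactSupport η) : Integrable (𝓕 fun ω => (η ω : ℂ)) := by
  have hc' : HasCompactSupport fun ω => (η ω : ℂ) := hc.comp_left (g := Complex.ofReal) rfl
  have hη' : ContDiff ℝ ((⊤ : ℕ∞) : WithTop ℕ∞) fun ω => (η ω : ℂ) :=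
    Complex.ofRealCLM.contDiff.comp hη
  exact (𝓕 (hc'.toSchwartzMap hη')).integrable

theorem integrable_windowTransform (hη : ContDiff ℝ ((⊤ : ℕ∞) : WithTop ℕ∞) η)
    (hc : HasCompactSupport η) : Integrable (windowTransform η) := by
  rw [funext (windowTransform_eq_fourier η)]
  exact (integrable_fourier_window hη hc).comp_div (by positivity)

/-- Fourier inversion after the substitution `t = 2πv`, whose Jacobian cancels `1/2π`. -/
theorem integral_windowTransform_mul_freqExp (hη : ContDiff ℝ ((⊤ : ℕ∞) : WithTop ℕ∞) η)
    (hc : HasCompactSupport η) (ω : ℝ) :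
    ∫ t, (((1 / (2 * Real.pi) : ℝ) : ℂ) * windowTransform η t) * freqExp t ω = η ω := by
  have hηc : Continuous fun ω => (η ω : ℂ) := Complex.continuous_ofReal.comp hη.continuous
  have hηi : Integrable fun ω => (η ω : ℂ) :=
    hηc.integrable_of_hasCompactSupport (hc.comp_left (g := Complex.ofReal) rfl)
  have hpi : (0 : ℝ) < 2 * Real.pi := by positivity
  have hsub := Measure.integral_comp_div
    (fun v => (((1 / (2 * Real.pi) : ℝ) : ℂ) * 𝓕 (fun ω => (η ω : ℂ)) v) *
      freqExp (2 * Real.pi * v) ω) (2 * Real.pi)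
  simp_rw [mul_div_cancel₀ _ hpi.ne'] at hsub
  simp_rw [windowTransform_eq_fourier]
  rw [hsub, ← hηi.fourierInv_fourier_eq (integrable_fourier_window hη hc) hηc.continuousAt,
    Real.fourierInv_eq', abs_of_pos hpi, ← integral_smul]
  congr 1
  ext v
  rw [Complex.real_smul, smul_eq_mul, freqExp]
  have h1 : ((2 * Real.pi : ℝ) : ℂ) * (((1 / (2 * Real.pi) : ℝ) : ℂ)) = 1 := by
    rw [← Complex.ofReal_mul, mul_one_div_cancel hpi.ne', Complex.ofReal_one]
  have h2 : ((2 * Real.pi * inner ℝ v ω : ℝ) : ℂ) * Complex.I =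
      ((2 * Real.pi * v : ℝ) : ℂ) * ω * Complex.I := by
    simp only [RCLike.inner_apply, conj_trivial]
    push_cast
    ring
  rw [h2, ← mul_assoc, ← mul_assoc, h1, one_mul, mul_comm]

end FourierWindow

/-! ### The window operators -/

section Window

variable {X : Type*} [MetricSpace X] [MeasurableSpace X] [BorelSpace X] {Φ : Flow ℝ X}
  {μ : Measure X} [IsProbabilityMeasure μ] (hΦ : IsErgodicFlow Φ μ) (S : ℝ) {h : ℕ → ℝ → ℝ}

theorem measurableSet_timeDomain (m n : ℕ) : MeasurableSet (timeDomain S m n) :=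
  measurableSet_Icc

theorem integrable_windowIntegrand {m : ℕ} (hc : Continuous (h m)) (hs : HasCompactSupport (h m))
    (n : ℕ) (f : Lp ℂ 2 μ) :
    Integrable (windowIntegrand hΦ S h m n f) (volume : Measure (ℝ × ℝ)) := by
  have hT : MeasurableSet (timeDomain S m n) := measurableSet_timeDomain S m n
  have hi1 : Integrable fun ω => |h m ω| := (hc.integrable_of_hasCompactSupport hs).abs
  have hi2 : Integrable ((timeDomain S m n).indicator fun _ => ‖f‖) :=
    (integrable_indicator_iff hT).2 (integrableOn_const (by
      rw [timeDomain, Real.volume_Icc]; exact ENNReal.ofReal_ne_top))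
  rw [Measure.volume_eq_prod]
  refine (hi1.mul_prod hi2).mono' ?_ (Eventually.of_forall fun p => ?_)
  · have h1 : Measurable fun p : ℝ × ℝ => (h m p.1 : ℂ) :=
      (Complex.continuous_ofReal.comp (hc.comp continuous_fst)).measurable
    have h2 : Measurable fun p : ℝ × ℝ => (timeDomain S m n).indicator (fun _ => (1 : ℂ)) p.2 :=
      (measurable_indicator_one hT).comp measurable_snd
    have h3 : Measurable fun p : ℝ × ℝ => Complex.exp (-(Complex.I * (p.1 : ℂ) * (p.2 : ℂ))) := by
      fun_prop
    exact ((h1.mul h2).mul h3).aestronglyMeasurable.smul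
      ((continuous_koopman hΦ f).comp continuous_snd).aestronglyMeasurable
  · have hexp : ‖Complex.exp (-(Complex.I * (p.1 : ℂ) * (p.2 : ℂ)))‖ = 1 := by
      rw [Complex.norm_exp]
      simp
    rw [windowIntegrand, norm_smul, norm_koopman, norm_mul, norm_mul, hexp, mul_one,
      Complex.norm_real, Real.norm_eq_abs]
    by_cases hp : p.2 ∈ timeDomain S m n <;> simp [hp]

theorem windowOperator_eq_integral {m : ℕ} (hc : Continuous (h m))
    (hs : HasCompactSupport (h m)) (n : ℕ) (f : Lp ℂ 2 μ) :
    windowOperator hΦ S h m n f = ∫ t, (timeDomain S m n).indicator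
      (fun t => (((1 / (2 * Real.pi) : ℝ) : ℂ) * windowTransform (h m) t) • koopman hΦ t f) t := by
  have hi := integrable_windowIntegrand hΦ S hc hs n f
  rw [Measure.volume_eq_prod] at hi
  rw [windowOperator, Measure.volume_eq_prod, integral_prod_symm _ hi, ← integral_smul]
  congr 1
  ext1 t
  simp only [windowIntegrand]
  rw [integral_smul_const, smul_smul]
  by_cases ht : t ∈ timeDomain S m n
  · simp only [ht, indicator_of_mem, mul_one]
    rfl
  · simp [ht]

variable {S} in
theorem tendsto_timeDomain_bound (hS : 0 < S) {m : ℕ} (hm : 1 ≤ m) :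
    Tendsto (fun n : ℕ => (n : ℝ) ^ 2 * S / ((m : ℝ) * (2 * (n : ℝ) + 1))) atTop atTop := by
  have hm' : (0 : ℝ) < m := by exact_mod_cast hm
  -- For `n ≥ 1`, `2n + 1 ≤ 3n` bounds the endpoint below by `S n / (3m)`.
  have h1 : Tendsto (fun n : ℕ => S / (3 * m) * (n : ℝ)) atTop atTop :=
    tendsto_natCast_atTop_atTop.const_mul_atTop (by positivity)
  refine tendsto_atTop_mono' _ ?_ h1
  filter_upwards [eventually_ge_atTop 1] with n hn
  have hn' : (1 : ℝ) ≤ n := by exact_mod_cast hn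
  rw [div_mul_eq_mul_div, div_le_div_iff₀ (by positivity) (by positivity)]
  have : 0 ≤ S * m * n * ((n : ℝ) - 1) := mul_nonneg (by positivity) (by linarith)
  nlinarith

-- For fixed `m` the integrands are dominated by `(1/2π) |ĥ_m(t)| ‖f‖`, and each `t` eventually lies
-- in the time domain.
variable {S} in
theorem tendsto_windowOperator (hS : 0 < S) {m : ℕ} (hm : 1 ≤ m)
    (hsm : ContDiff ℝ ((⊤ : ℕ∞) : WithTop ℕ∞) (h m)) (hs : HasCompactSupport (h m))
    (f : Lp ℂ 2 μ) :
    Tendsto (fun n => windowOperator hΦ S h m n f) atTop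
      (𝓝 (∫ t, (((1 / (2 * Real.pi) : ℝ) : ℂ) * windowTransform (h m) t) • koopman hΦ t f)) := by
  have hi : Integrable fun t => ((1 / (2 * Real.pi) : ℝ) : ℂ) * windowTransform (h m) t :=
    (integrable_windowTransform hsm hs).const_mul _
  have hmeas : AEStronglyMeasurable fun t =>
      (((1 / (2 * Real.pi) : ℝ) : ℂ) * windowTransform (h m) t) • koopman hΦ t f :=
    hi.1.smul (continuous_koopman hΦ f).aestronglyMeasurable
  simp_rw [windowOperator_eq_integral hΦ S hsm.continuous hs]
  refine tendsto_integral_of_dominated_convergence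
    (fun t => ‖((1 / (2 * Real.pi) : ℝ) : ℂ) * windowTransform (h m) t‖ * ‖f‖)
    (fun n => hmeas.indicator (measurableSet_timeDomain S m n)) (hi.norm.mul_const _)
    (fun n => Eventually.of_forall fun t => ?_) (Eventually.of_forall fun t => ?_)
  · refine (norm_indicator_le_norm_self _ _).trans ?_
    rw [norm_smul, norm_koopman]
  · refine tendsto_const_nhds.congr' ?_
    filter_upwards [(tendsto_timeDomain_bound hS hm).eventually_ge_atTop |t|] with n hn
    rw [indicator_of_mem (show t ∈ timeDomain S m n from abs_le.1 hn)]

end Window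

namespace ProjectionValuedMeasure

variable {H : Type*} [NormedAddCommGroup H] [InnerProductSpace ℂ H] [CompleteSpace H]

/-- Fourier synthesis: a window of the generator is the window transform integrated against the
group. -/
theorem IsSpectralMeasureOf.integral_windowTransform_smul {E : ProjectionValuedMeasure ℝ H}
    {U : ℝ → H →L[ℂ] H} (hU : IsUnitaryGroup U)
    (hE : E.IsSpectralMeasureOf (fun ω : ℝ => Complex.I * (ω : ℂ)) (generator U)) {η : ℝ → ℝ}
    (hη : ContDiff ℝ ((⊤ : ℕ∞) : WithTop ℕ∞) η) (hc : HasCompactSupport η) (f : H) :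
    ∫ t, (((1 / (2 * Real.pi) : ℝ) : ℂ) * windowTransform η t) • U t f =
      E.specInt f fun ω => (η ω : ℂ) := by
  have hi : Integrable fun t => ((1 / (2 * Real.pi) : ℝ) : ℂ) * windowTransform η t :=
    (integrable_windowTransform hη hc).const_mul _
  obtain ⟨C, hC⟩ := hc.exists_bound_of_continuous hη.continuous
  have hm : MemLp (fun ω => (η ω : ℂ)) 2 (E.scalarMeasure f) :=
    memLp_two_of_norm_le (C := C)
      (Complex.continuous_ofReal.comp hη.continuous).aestronglyMeasurable fun ω => by
        rw [Complex.norm_real]; exact hC ω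
  rw [specInt, ← integral_smul_l2Class_freqExp _ hi hm
    (integral_windowTransform_mul_freqExp hη hc)]
  have := (E.isometry f).toContinuousLinearMap.integral_comp_comm
    (integrable_smul_l2Class_freqExp (E.scalarMeasure f) hi)
  refine Eq.trans ?_ this
  congr 1
  ext1 t
  rw [map_smul, hE.apply_eq_specInt_freqExp hU t f]
  rfl

end ProjectionValuedMeasure

/-- Stone's theorem serves only to rule out the default value `0`. The chosen `E` need not be the
constructed one, so later steps use only that it is a spectral measure. -/
theorem exists_isSpectralMeasureOf_posFreqProjection {X : Type*} [MetricSpace X]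
    [MeasurableSpace X] [BorelSpace X] {Φ : Flow ℝ X} {μ : Measure X} [IsProbabilityMeasure μ]
    (hΦ : IsErgodicFlow Φ μ) : ∃ E : ProjectionValuedMeasure ℝ (Lp ℂ 2 μ),
      E.IsSpectralMeasureOf (fun ω : ℝ => Complex.I * (ω : ℂ)) (generator (koopman hΦ)) ∧
      posFreqProjection hΦ = E.proj (Ioi 0) := by
  have hex : ∃ E : ProjectionValuedMeasure ℝ (Lp ℂ 2 μ),
      E.IsSpectralMeasureOf (fun ω : ℝ => Complex.I * (ω : ℂ)) (generator (koopman hΦ)) :=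
    ⟨_, (isUnitaryGroup_koopman hΦ).isSpectralMeasureOf_generator⟩
  refine ⟨hex.choose, hex.choose_spec, ?_⟩
  rw [posFreqProjection, skewSpectralProjection, dif_pos hex]

end

theorem mainTheorem3 {X : Type*} [MetricSpace X] [MeasurableSpace X] [BorelSpace X]
    (Φ : Flow ℝ X) (μ : Measure X) [IsProbabilityMeasure μ] (hsupp : IsCompact μ.support)
    (hΦ : IsErgodicFlow Φ μ) (S : ℝ) (hS : 0 < S) (h : ℕ → ℝ → ℝ)
    (h_smooth : ∀ m, 1 ≤ m → ContDiff ℝ ((⊤ : ℕ∞) : WithTop ℕ∞) (h m))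
    (h_nonneg : ∀ m, 1 ≤ m → ∀ ω, 0 ≤ h m ω)
    (h_supp : ∀ m, 1 ≤ m → tsupport (h m) ⊆ Icc 0 (2 * Real.pi * (m : ℝ) / S))
    (h_bdd : ∃ C : ℝ, ∀ m, 1 ≤ m → ∀ ω, h m ω ≤ C)
    (h_lim : ∀ ω, Tendsto (fun m => h m ω) atTop (𝓝 ((Ioi (0 : ℝ)).indicator (fun _ => 1) ω))) :
    (∀ m n, 1 ≤ m → 1 ≤ n → ∀ f : Lp ℂ 2 μ,
      Integrable (windowIntegrand hΦ S h m n f) (volume : Measure (ℝ × ℝ))) ∧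
    ∀ f : Lp ℂ 2 μ, ∃ g : ℕ → Lp ℂ 2 μ,
      (∀ m, 1 ≤ m → Tendsto (fun n => windowOperator hΦ S h m n f) atTop (𝓝 (g m))) ∧
      Tendsto g atTop (𝓝 (posFreqProjection hΦ f)) := by
  have h_cpt : ∀ m, 1 ≤ m → HasCompactSupport (h m) := fun m hm =>
    isCompact_Icc.of_isClosed_subset (isClosed_tsupport _) (h_supp m hm)
  obtain ⟨E, hE, hproj⟩ := exists_isSpectralMeasureOf_posFreqProjection hΦ
  obtain ⟨C, hC⟩ := h_bdd
  -- The inner limit is `(∫ h_m dE) f`.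
  refine ⟨fun m n hm _ f => integrable_windowIntegrand hΦ S (h_smooth m hm).continuous
    (h_cpt m hm) n f, fun f => ⟨fun m => E.specInt f fun ω => (h m ω : ℂ), fun m hm => ?_, ?_⟩⟩
  · beta_reduce
    rw [← hE.integral_windowTransform_smul (isUnitaryGroup_koopman hΦ) (h_smooth m hm)
      (h_cpt m hm) f]
    exact tendsto_windowOperator hΦ hS hm (h_smooth m hm) (h_cpt m hm) f
  -- The index shift discards `m = 0`, about which smoothness, sign and bound say nothing. The
  -- dominating constant `max C 1` covers both the windows and the limiting indicator.
  · rw [hproj, ← E.specInt_indicator f measurableSet_Ioi, ← tendsto_add_atTop_iff_nat 1]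
    refine E.tendsto_specInt_of_dominated (G := fun _ => max C 1)
      (fun m => (Complex.continuous_ofReal.comp
        (h_smooth (m + 1) (Nat.le_add_left 1 m)).continuous).measurable)
      (measurable_indicator_one measurableSet_Ioi) (memLp_const _)
      (Eventually.of_forall fun m ω => ?_)
      (fun ω => (norm_indicator_one_le _ ω).trans (le_max_right C 1)) fun ω => ?_
    · rw [Complex.norm_real, Real.norm_of_nonneg (h_nonneg _ (Nat.le_add_left 1 m) ω)]
      exact (hC _ (Nat.le_add_left 1 m) ω).trans (le_max_left C 1)
    · have h1 := (Complex.continuous_ofReal.tendsto _).comp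
        ((tendsto_add_atTop_iff_nat 1).2 (h_lim ω))
      have h2 : (((Ioi (0 : ℝ)).indicator (fun _ => (1 : ℝ)) ω : ℝ) : ℂ) =
          (Ioi (0 : ℝ)).indicator (fun _ => (1 : ℂ)) ω := by
        by_cases hω : 0 < ω <;> simp [indicator, hω]
      rwa [h2] at h1
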